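/- \textbf{Model.} Let $G=(U,V,E)$ be a finite bipartite graph with offline nodes $U$ and online nodes $V$, where $V=V_P\sqcup V_A$ is split into predicted nodes $V_P$ and adversarial nodes $V_A$. Let $H=G[U\cup V_P]$ be the predicted graph. A randomized semi-online matching algorithm is given $H$ in advance. Afterwards the nodes of $V$ arrive one at a time, in an arbitrary order. When a node arrives, the algorithm sees its set of neighbours in $U$, and must irrevocably match it to a neighbour that is still unmatched, or abandon it. $G$, $V_A$ and the arrival order are fixed before the random choices of the algorithm are made. Write $\nu(\cdot)$ for the size of a maximum matching and $\Gamma(\cdot)$ for the set of neighbours in $H$. \textbf{Structured Sampling.} Suppose $\nu(H)=|V_P|$. A matching skeleton of $H$ consists of a partition of $V_P$ into sets $S_0,\dots,S_m$, a partition of $U$ into nonempty sets $T_0,\dots,T_m$ (there are no parts at all if $U=\emptyset$), and a fractional matching $x$ in $H$ such that \begin{itemize} \item $\Gamma(\bigcup_{i<j}S_i)=\bigcup_{i<j}T_i$ for all $0\le j\le m$; \item $|S_i|/|T_i|>|S_j|/|T_j|$ for all $i<j$; \item $x_{vu}=0$ unless $v\in S_i$ and $u\in T_i$ for some common $i$;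 every $v \in V_P$ has fractional degree $1$, and every $u\in T_i$ has fractional degree $|S_i|/|T_i|$. \end{itemize} (The last set $S_m$ may be empty, and then $T_m$ consists of the isolated offline nodes.) A dependent rounding of the component $(S_i,T_i)$ is a random matching $M_i$ in $H$ of size $|S_i|$ between $S_i$ and $T_i$ that contains each edge $(v,u)$, $v\in S_i$, $u\in T_i$, with probability $x_{vu}$; in particular each $u\in T_i$ is matched with probability $|S_i|/|T_i|$. Structured Sampling takes a matching skeleton of $H$, samples dependent roundings $M_i$ of its components independently, sets $M=\bigcup_i M_i$, and takes a uniformly random ordering $R$ of the reserved nodes, i.e. of the offline nodes that $M$ leaves unmatched. When a node $v$ arrives, it is recognized as a predicted node if some predicted node with the same neighbourhood has not been seen yet; in this case it is identified with such a node and matched to $M(v)$. Otherwise $v$ is matched to its first unmatched neighbour in $R$, if there is one (RANKING). \textbf{Theorem.} There is a randomized semi-online bipartite matching algorithm that is Structured Sampling, for some choice of matching skeletons and dependent roundings, on every predicted graph $H$ with $\nu(H)=|V_P|$; in particular such skeletons and roundings always exist. Moreover, every such algorithm has expected competitive ratio at least $1-\delta+\delta^2(1-1/e)$ when $G$ has a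 perfect matching. That is, for every $G$ with a perfect matching, every set $V_P \subseteq V$ and every arrival order, the expected size of the matching that it builds is at least $$\Bigl(1-\delta+\delta^2\bigl(1-\tfrac1e\bigr)\Bigr)\,\nu(G),\qquad \delta=\frac{d}{n},\quad n=|U|=|V|\ge 1,\quad d=|V_A|.$$ -/

import Mathlib

open scoped ENNReal

universe u

/-! Bipartite graphs. A bipartite graph with offline nodes `U` and online nodes `V` is given by the
neighbourhoods `G v : Finset U` of its online nodes. -/

namespace SemiOnline

section Graphs

variable {U V : Type*}

/-- A set of edges `(v, u)` of the bipartite graph `G`, no two of which share an endpoint. -/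
def IsMatching (G : V → Finset U) (M : Finset (V × U)) : Prop :=
  (∀ e ∈ M, e.2 ∈ G e.1) ∧
  (∀ e ∈ M, ∀ f ∈ M, e.1 = f.1 → e = f) ∧
  (∀ e ∈ M, ∀ f ∈ M, e.2 = f.2 → e = f)

/-- The size `ν(G)` of a maximum matching of `G`. -/
noncomputable def matchingNumber [Fintype U] [Fintype V] (G : V → Finset U) : ℕ :=
  open Classical in (Finset.univ.filter fun M => IsMatching G M).sup Finset.card

/-- `G` has a matching that covers every node, online and offline. -/
def HasPerfectMatching (G : V → Finset U) : Prop :=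
  ∃ M : Finset (V × U), IsMatching G M ∧ (∀ v, ∃ u, (v, u) ∈ M) ∧ (∀ u, ∃ v, (v, u) ∈ M)

end Graphs

/-! The semi-online model. -/

section Model

/-- A deterministic online strategy: when an online node with neighbourhood `N` is revealed, after
nodes with neighbourhoods `past` (in order of arrival), the node is matched to `u` if
`σ past N = some u`, and abandoned if `σ past N = none`. The strategy sees nothing but the
neighbourhoods of the nodes that have arrived; in particular it is not told whether a node is
predicted or adversarial. -/
def OnlineStrategy (U : Type*) : Type _ :=
  List (Finset U) → Finset U → Option U

namespace OnlineStrategy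

variable {U : Type*}

/-- The decision on the `i`-th node, when nodes with neighbourhoods `l` arrive one by one. -/
def choice (σ : OnlineStrategy U) (l : List (Finset U)) (i : Fin l.length) : Option U :=
  σ (l.take i) (l.get i)

/-- On every input the decisions form a matching: a node is matched only to a neighbour that no
earlier node was matched to. -/
def Feasible (σ : OnlineStrategy U) : Prop :=
  ∀ (l : List (Finset U)) (i : Fin l.length) (u : U), σ.choice l i = some u →
    u ∈ l.get i ∧ ∀ j < i, σ.choice l j ≠ some u

/-- The number of online nodes that are matched. -/
def size (σ : OnlineStrategy U) (l : List (Finset U)) : ℕ :=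
  (Finset.univ.filter fun i => (σ.choice l i).isSome = true).card

end OnlineStrategy

/-- The expected size of the matching built by a random online strategy with law `p`, when nodes
with neighbourhoods `l` arrive one by one. -/
noncomputable def expectedSize {U : Type*} (p : PMF (OnlineStrategy U)) (l : List (Finset U)) : ℝ :=
  ∑' σ, (p σ).toReal * (σ.size l : ℝ)

/-- A randomized semi-online matching algorithm: given the offline nodes `U` and the predicted graph
`H`, whose online side is the set `P` of predicted nodes, it draws at random a feasible strategy for
the online phase. -/
structure SemiOnlineAlgorithm where
  law : ∀ (U P : Type u) [Fintype U] [DecidableEq U] [Fintype P] [DecidableEq P]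
    (_ : P → Finset U), PMF (OnlineStrategy U)
  feasible : ∀ (U P : Type u) [Fintype U] [DecidableEq U] [Fintype P] [DecidableEq P]
    (H : P → Finset U), ∀ σ ∈ (law U P H).support, σ.Feasible

end Model

/-! Structured Sampling. -/

section StructuredSampling

variable {U P : Type*} [Fintype U] [DecidableEq U] [Fintype P] [DecidableEq P]

/-- Values in `[0, 1]` on the edges of `H`, with fractional degree at most `1` at every node (and
the value `0` outside the edges). -/
structure IsFractionalMatching (H : P → Finset U) (x : P → U → ℝ) : Prop where
  nonneg : ∀ v u, 0 ≤ x v u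
  le_one : ∀ v u, x v u ≤ 1
  support : ∀ v u, u ∉ H v → x v u = 0
  online_degree_le : ∀ v, ∑ u, x v u ≤ 1
  offline_degree_le : ∀ u, ∑ v, x v u ≤ 1

/-- A matching skeleton of `H`: partitions `S 0, …, S (k-1)` of the online side and
`T 0, …, T (k-1)` of the offline side, with a fractional matching `x`. The partitions are given by
the functions that map a node to the index of its part. The sets `T i` are nonempty; `S i` can be
empty (for the last index only), and then `T i` is the set of isolated offline nodes. -/
structure MatchingSkeleton (H : P → Finset U) where
  k : ℕ
  sIndex : P → Fin k
  tIndex : U → Fin k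
  x : P → U → ℝ
  tIndex_surjective : Function.Surjective tIndex
  /-- `Γ(⋃_{i<j} S i) = ⋃_{i<j} T i` -/
  neighbors : ∀ (j : Fin k) (u : U), (∃ v, sIndex v < j ∧ u ∈ H v) ↔ tIndex u < j
  /-- `|S i| / |T i| > |S j| / |T j|` for `i < j` -/
  ratio_strictAnti : StrictAnti fun i : Fin k =>
    ((Finset.univ.filter fun v => sIndex v = i).card : ℝ) /
      ((Finset.univ.filter fun u => tIndex u = i).card : ℝ)
  fractional : IsFractionalMatching H x
  /-- nodes of `S i` are fractionally matched only to nodes of `T i`, and vice versa -/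
  within : ∀ v u, sIndex v ≠ tIndex u → x v u = 0
  online_degree : ∀ v, ∑ u, x v u = 1
  offline_degree : ∀ u, ∑ v, x v u =
    ((Finset.univ.filter fun v => sIndex v = tIndex u).card : ℝ) /
      ((Finset.univ.filter fun u' => tIndex u' = tIndex u).card : ℝ)

namespace MatchingSkeleton

variable {H : P → Finset U}

/-- The part `S i` of the online side. -/
def S (K : MatchingSkeleton H) (i : Fin K.k) : Finset P := Finset.univ.filter fun v => K.sIndex v = i

/-- The part `T i` of the offline side. -/
def T (K : MatchingSkeleton H) (i : Fin K.k) : Finset U := Finset.univ.filter fun u => K.tIndex u = i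

/-- `D` is the law of a random matching obtained from the `i`-th component by dependent rounding: a
matching of size `|S i|` between `S i` and `T i`, which contains each edge `(v, u)` with probability
`x v u`. Hence each node of `T i` is matched with probability `|S i| / |T i|`. -/
def IsRounding (K : MatchingSkeleton H) (i : Fin K.k) (D : PMF (Finset (P × U))) : Prop :=
  (∀ M ∈ D.support, IsMatching H M ∧ M ⊆ K.S i ×ˢ K.T i ∧ M.card = (K.S i).card) ∧
  ∀ v ∈ K.S i, ∀ u ∈ K.T i, D.toOuterMeasure {M | (v, u) ∈ M} = ENNReal.ofReal (K.x v u)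

end MatchingSkeleton

/-- The law of a family of independent random variables with laws `D i`. -/
noncomputable def independentLaw {k : ℕ} {α : Type*} [Fintype α] (D : Fin k → PMF α) :
    PMF (Fin k → α) :=
  PMF.ofFintype (fun f => ∏ i, D i (f i)) (by
    classical
    have h : ∀ i, ∑ a, D i a = 1 := fun i => by
      rw [← tsum_fintype (L := SummationFilter.unconditional _)]
      exact (D i).tsum_coe
    rw [← Fintype.piFinset_univ, ← Finset.prod_univ_sum]
    simp [h])

/-- An online node with neighbourhood `N` is recognized as a predicted node with the same
neighbourhood that has not been seen before, if there is one. -/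
noncomputable def recognize (H : P → Finset U) (seen : Finset P) (N : Finset U) : Option P :=
  (Finset.univ : Finset P).toList.find? fun v => decide (H v = N ∧ v ∉ seen)

/-- The offline node `M(v)` that the matching `M` matches to `v`. -/
noncomputable def partner (M : Finset (P × U)) (v : P) : Option U :=
  (Finset.univ : Finset U).toList.find? fun u => decide ((v, u) ∈ M)

/-- The decision of the online phase on a node with neighbourhood `N`, when the predicted nodes in
`seen` have arrived and the offline nodes in `used` are matched: a predicted node `v` is matched to
`M(v)`, any other node to its first unmatched neighbour in the sequence `R`, if one exists. -/
noncomputable def onlineDecision (H : P → Finset U) (M : Finset (P × U)) (R : List U)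
    (seen : Finset P) (used : Finset U) (N : Finset U) : Option U :=
  match recognize H seen N with
  | some v => partner M v
  | none => R.find? fun u => decide (u ∈ N ∧ u ∉ used)

/-- The sets `seen` and `used` after the nodes with neighbourhoods `past` have arrived. -/
noncomputable def onlineState (H : P → Finset U) (M : Finset (P × U)) (R : List U)
    (past : List (Finset U)) : Finset P × Finset U :=
  past.foldl (fun s N =>
    (s.1 ∪ (recognize H s.1 N).toFinset, s.2 ∪ (onlineDecision H M R s.1 s.2 N).toFinset)) (∅, ∅)

/-- The online phase: predicted nodes follow `M`, all others are matched by RANKING with respect to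
the sequence `R` of reserved offline nodes. -/
noncomputable def onlinePhase (H : P → Finset U) (M : Finset (P × U)) (R : List U) :
    OnlineStrategy U :=
  fun past N =>
    onlineDecision H M R (onlineState H M R past).1 (onlineState H M R past).2 N

/-- The offline nodes that `M` leaves unmatched. -/
def reserved (M : Finset (P × U)) : Finset U :=
  Finset.univ.filter fun u => ∀ v, (v, u) ∉ M

/-- A uniformly random ordering of a finite set of nodes. -/
noncomputable def uniformOrdering (A : Finset U) : PMF (List U) :=
  haveI : Nonempty (Fin A.card ≃ A) := ⟨A.equivFin.symm⟩
  (PMF.uniformOfFintype (Fin A.card ≃ A)).map fun e => List.ofFn fun i => (e i : U)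

/-- Structured Sampling with the matching skeleton `K` and the laws `D i` of random matchings in its
components: sample the matchings `M i` independently, let `M` be their union, and run the online
phase with `M` and a uniformly random ordering of the offline nodes not matched by `M`. -/
noncomputable def structuredSampling {H : P → Finset U} (K : MatchingSkeleton H)
    (D : Fin K.k → PMF (Finset (P × U))) : PMF (OnlineStrategy U) :=
  (independentLaw D).bind fun Mi =>
    let M : Finset (P × U) := Finset.univ.biUnion Mi
    (uniformOrdering (reserved M)).map fun R => onlinePhase H M R

end StructuredSampling

/-- On every predicted graph that has a matching covering all predicted nodes, the algorithm is
Structured Sampling, with some matching skeleton and some dependent rounding of its components. -/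
def SemiOnlineAlgorithm.IsStructuredSampling (alg : SemiOnlineAlgorithm.{u}) : Prop :=
  ∀ (U P : Type u) [Fintype U] [DecidableEq U] [Fintype P] [DecidableEq P] (H : P → Finset U),
    matchingNumber H = Fintype.card P →
    ∃ (K : MatchingSkeleton H) (D : Fin K.k → PMF (Finset (P × U))),
      (∀ i, K.IsRounding i (D i)) ∧ alg.law U P H = structuredSampling K D

/-- The algorithm is feasible by definition; when the realized graph `G` has a perfect matching, its
expected matching size is at least `ρ(δ) * ν(G)`, with `δ = d / n`, for every choice of the set `VP`
of predicted nodes and every order of arrival. The predicted graph is the restriction of `G` to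
`VP`. -/
def SemiOnlineAlgorithm.IsCompetitive (alg : SemiOnlineAlgorithm.{u}) (ρ : ℝ → ℝ) : Prop :=
  ∀ (U V : Type u) [Fintype U] [DecidableEq U] [Fintype V] [DecidableEq V]
    (G : V → Finset U) (VP : Finset V) (order : Fin (Fintype.card V) ≃ V),
    HasPerfectMatching G →
    ρ ((VPᶜ.card : ℝ) / (Fintype.card V : ℝ)) * (matchingNumber G : ℝ) ≤
      expectedSize (alg.law U {v // v ∈ VP} fun v => G v.1) (List.ofFn fun i => G (order i))

end SemiOnline

/-! Fix a perfect matching `m` of the realized graph, let `n = |U|` and let `d` be the number of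
adversarial nodes. Write `y u` for the fractional degree of `u` in the skeleton, so that `u` is
reserved with probability `1 - y u`. Three facts give the bound.

The online phase sees only neighbourhoods. An adversarial node may be mistaken for a predicted one,
but then a twin with the same neighbourhood takes its place. So all `n - d` predicted nodes are
matched by `M`, and RANKING faces, in some order, exactly the neighbourhoods of the adversarial
nodes (`matchedCount_eq`).

RANKING is `1 - 1/e` competitive against any matching into the reserved nodes, in particular against
the edges of `m` from adversarial nodes to reserved nodes (`ranking_competitive`). This is the
randomized primal-dual argument: a matched offline node of rank `y` in `[0, 1]` receives `exp (y -
1)`, its partner receives the rest, and every edge has expected dual value at least `1 - 1/e`. Since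
orderings are uniform on finite lists, `exp (y - 1)` is replaced by its expectation at an order
statistic, an integral against a Bernstein polynomial. The continuous identity `∫₀ᶜ exp (y - 1) + 1
- exp (c - 1) = 1 - 1/e` becomes `sum_rankWeight_prefix`.

The expected number of adversarial nodes with reserved mates is at least `d² / n`. In a skeleton
every neighbour of a predicted node `v` has degree at least the ratio of the component of `v`.
Summing this over the predicted nodes and applying Cauchy–Schwarz shows that their mates have total
degree at least `(n - d)² / n` (`MatchingSkeleton.card_sq_le`). All degrees add up to `n - d`, so
the mates of adversarial nodes have total degree at most `d (n - d) / n`.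

In total the expected size is at least `n - d + (1 - 1/e) d² / n`. Existence of skeletons follows by
minimizing the sum of squared offline degrees, and existence of roundings from Birkhoff's theorem.
-/

/-! Weights for the dual solution of RANKING: the expectations of `exp (y - 1)` at the order
statistics `y` of independent uniform variables. -/

namespace SemiOnline

section Weights

open Polynomial

/-- The integral of a polynomial on `[0, 1]` against `exp (y - 1)`. -/
noncomputable def expIntegral (p : ℝ[X]) : ℝ := ∫ y in (0 : ℝ)..1, p.eval y * Real.exp (y - 1)

theorem intervalIntegrable_eval_mul_exp (p : ℝ[X]) :
    IntervalIntegrable (fun y => p.eval y * Real.exp (y - 1)) MeasureTheory.volume 0 1 :=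
  (p.continuous.mul (by fun_prop)).intervalIntegrable _ _

theorem expIntegral_add (p q : ℝ[X]) : expIntegral (p + q) = expIntegral p + expIntegral q := by
  simp only [expIntegral, eval_add, add_mul]
  exact intervalIntegral.integral_add (intervalIntegrable_eval_mul_exp p)
    (intervalIntegrable_eval_mul_exp q)

theorem expIntegral_C_mul (c : ℝ) (p : ℝ[X]) : expIntegral (C c * p) = c * expIntegral p := by
  simp only [expIntegral, eval_mul, eval_C, mul_assoc]
  exact intervalIntegral.integral_const_mul _ _

theorem expIntegral_sum (s : Finset ℕ) (p : ℕ → ℝ[X]) :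
    expIntegral (∑ i ∈ s, p i) = ∑ i ∈ s, expIntegral (p i) := by
  simp only [expIntegral, eval_finsetSum, Finset.sum_mul]
  exact intervalIntegral.integral_finsetSum fun i _ => intervalIntegrable_eval_mul_exp (p i)

theorem expIntegral_by_parts (p : ℝ[X]) :
    expIntegral p = p.eval 1 - p.eval 0 * Real.exp (-1) - expIntegral (derivative p) := by
  have h := intervalIntegral.integral_mul_deriv_eq_deriv_mul (a := 0) (b := 1)
    (u := fun y => p.eval y) (u' := fun y => (derivative p).eval y)
    (v := fun y => Real.exp (y - 1)) (v' := fun y => Real.exp (y - 1))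
    (fun y _ => p.hasDerivAt y)
    (fun y _ => by simpa using ((hasDerivAt_id y).sub_const 1).exp)
    ((derivative p).continuous.intervalIntegrable _ _)
    (Continuous.intervalIntegrable (by fun_prop) _ _)
  simpa [expIntegral] using h

theorem bernstein_eval_nonneg (n i : ℕ) {y : ℝ} (h0 : 0 ≤ y) (h1 : y ≤ 1) :
    0 ≤ (bernsteinPolynomial ℝ n i).eval y := by
  have : 0 ≤ 1 - y := by linarith
  simp only [bernsteinPolynomial, eval_mul, eval_natCast, eval_pow, eval_X, eval_sub, eval_one]
  positivity

theorem expIntegral_bernstein_nonneg (n i : ℕ) : 0 ≤ expIntegral (bernsteinPolynomial ℝ n i) :=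
  intervalIntegral.integral_nonneg zero_le_one fun _ hy =>
    mul_nonneg (bernstein_eval_nonneg n i hy.1 hy.2) (Real.exp_pos _).le

/-- Order statistics under insertion: a new uniform point among `n + 1` others falls below the one
at position `c` in `c + 1` of the `n + 2` possible positions, moving it to `c + 1`, and otherwise
leaves it at `c`. The mixture of the two densities is the original density. -/
theorem bernstein_recursion {n c : ℕ} (hc : c ≤ n) :
    C ((c : ℝ) + 1) * bernsteinPolynomial ℝ (n + 1) (c + 1) +
      C ((n : ℝ) + 1 - c) * bernsteinPolynomial ℝ (n + 1) c =
      C ((n : ℝ) + 1) * bernsteinPolynomial ℝ n c := by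
  have h1 : ((n + 1).choose (c + 1) : ℝ) * (c + 1) = (n + 1) * n.choose c := by
    exact_mod_cast (Nat.add_one_mul_choose_eq n c).symm
  have h2 : ((n + 1).choose c : ℝ) * (n + 1 - c) = (n + 1) * n.choose c := by
    have := Nat.choose_mul_succ_eq n c
    rw [mul_comm ((n : ℝ) + 1), ← Nat.cast_succ, ← Nat.cast_sub (by omega)]
    exact_mod_cast this.symm
  have h3 : n + 1 - c = (n - c) + 1 := by omega
  have h1' := congrArg (C : ℝ → ℝ[X]) h1
  have h2' := congrArg (C : ℝ → ℝ[X]) h2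
  simp only [C_mul, C_eq_natCast] at h1' h2'
  simp only [bernsteinPolynomial, Nat.add_sub_add_right, h3, pow_succ]
  linear_combination (X ^ c * X * (1 - X) ^ (n - c)) * h1' +
    (X ^ c * (1 - X) * (1 - X) ^ (n - c)) * h2'

theorem derivative_sum_bernstein (n c : ℕ) :
    derivative (∑ i ∈ Finset.range (c + 1), bernsteinPolynomial ℝ (n + 1) i) =
      C (-((n : ℝ) + 1)) * bernsteinPolynomial ℝ n c := by
  induction c with
  | zero => simp [bernsteinPolynomial.derivative_zero]
  | succ c ih =>
    rw [Finset.sum_range_succ, derivative_add, ih, bernsteinPolynomial.derivative_succ]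
    simp
    ring

/-- The expectation of `exp (y - 1)` at the `i`-th smallest `y` of `n + 1` independent uniform
variables on `[0, 1]`. -/
noncomputable def rankWeight (n i : ℕ) : ℝ :=
  ((n : ℝ) + 1) * expIntegral (bernsteinPolynomial ℝ n i)

theorem rankWeight_nonneg (n i : ℕ) : 0 ≤ rankWeight n i :=
  mul_nonneg (by positivity) (expIntegral_bernstein_nonneg n i)

/-- Integrate `bernsteinPolynomial (n + 1) (i + 1)` by parts: it vanishes at both endpoints, and its
derivative is a multiple of the difference of the two neighbouring Bernstein polynomials, so the
difference of the weights is a nonnegative integral. -/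
theorem rankWeight_le_succ {n i : ℕ} (h : i < n) : rankWeight n i ≤ rankWeight n (i + 1) := by
  have h1 := expIntegral_by_parts (bernsteinPolynomial ℝ (n + 1) (i + 1))
  have h2 := expIntegral_bernstein_nonneg (n + 1) (i + 1)
  have h3 : derivative (bernsteinPolynomial ℝ (n + 1) (i + 1)) =
      C ((n : ℝ) + 1) * (bernsteinPolynomial ℝ n i + C (-1) * bernsteinPolynomial ℝ n (i + 1)) := by
    rw [bernsteinPolynomial.derivative_succ]
    simp only [C_add, C_neg, C_1, C_eq_natCast, Nat.add_sub_cancel]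
    push_cast
    ring
  rw [bernsteinPolynomial.eval_at_1, bernsteinPolynomial.eval_at_0, h3, expIntegral_C_mul,
    expIntegral_add, expIntegral_C_mul, if_neg (by omega), if_neg (by omega)] at h1
  simp only [rankWeight]
  linarith

theorem rankWeight_mono {n i j : ℕ} (hij : i ≤ j) (hj : j ≤ n) :
    rankWeight n i ≤ rankWeight n j := by
  induction j, hij using Nat.le_induction with
  | base => exact le_rfl
  | succ j _ ih => exact (ih (by omega)).trans (rankWeight_le_succ (by omega))

theorem rankWeight_le_one {n i : ℕ} (h : i ≤ n) : rankWeight n i ≤ 1 := by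
  refine (rankWeight_mono h le_rfl).trans ?_
  have h1 : expIntegral (bernsteinPolynomial ℝ n n) ≤ ∫ y in (0 : ℝ)..1, y ^ n := by
    refine intervalIntegral.integral_mono_on zero_le_one (intervalIntegrable_eval_mul_exp _)
      (Continuous.intervalIntegrable (by fun_prop) _ _) fun y hy => ?_
    have : (bernsteinPolynomial ℝ n n).eval y = y ^ n := by simp [bernsteinPolynomial]
    rw [this]
    exact mul_le_of_le_one_right (pow_nonneg hy.1 n) (Real.exp_le_one_iff.2 (by linarith [hy.2]))
  rw [integral_pow] at h1
  simp only [one_pow, ne_eq, Nat.add_eq_zero_iff, one_ne_zero, and_false, not_false_eq_true,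
    zero_pow, sub_zero] at h1
  have h2 : (0 : ℝ) < n + 1 := by positivity
  rw [le_div_iff₀ h2] at h1
  rw [rankWeight]
  linarith

theorem sum_rankWeight (n : ℕ) :
    ∑ i ∈ Finset.range (n + 1), rankWeight n i = ((n : ℝ) + 1) * (1 - 1 / Real.exp 1) := by
  simp only [rankWeight]
  rw [← Finset.mul_sum, ← expIntegral_sum, bernsteinPolynomial.sum, expIntegral_by_parts]
  simp [expIntegral, Real.exp_neg]

/-- Discrete form of `∫₀ᶜ exp (y - 1) + 1 - exp (c - 1) = 1 - 1/e`. Integration by parts evaluates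
the prefix sum, whose derivative telescopes to one Bernstein polynomial of lower degree;
`bernstein_recursion` identifies that term with the two subtracted weights. -/
theorem sum_rankWeight_prefix {n c : ℕ} (hc : c < n) :
    ∑ i ∈ Finset.range (c + 1), rankWeight n i + ((n : ℝ) + 1) - (c + 1) * rankWeight n (c + 1) -
      (n - c) * rankWeight n c = ((n : ℝ) + 1) * (1 - 1 / Real.exp 1) := by
  obtain ⟨n, rfl⟩ : ∃ k, n = k + 1 := ⟨n - 1, by omega⟩
  have h1 := congrArg expIntegral (bernstein_recursion (n := n) (c := c) (by omega))
  rw [expIntegral_add, expIntegral_C_mul, expIntegral_C_mul, expIntegral_C_mul] at h1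
  have h2 := expIntegral_by_parts (∑ i ∈ Finset.range (c + 1), bernsteinPolynomial ℝ (n + 1) i)
  rw [derivative_sum_bernstein, expIntegral_C_mul, expIntegral_sum] at h2
  simp only [eval_finsetSum, bernsteinPolynomial.eval_at_0, bernsteinPolynomial.eval_at_1] at h2
  rw [Finset.sum_eq_zero (fun i hi => if_neg (by rw [Finset.mem_range] at hi; omega))] at h2
  simp only [Finset.sum_ite_eq', Finset.mem_range, Nat.succ_pos, if_true, Real.exp_neg] at h2
  simp only [rankWeight]
  rw [← Finset.mul_sum, h2]
  push_cast at h1 ⊢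
  rw [one_div]
  linear_combination (-((n : ℝ) + 1 + 1)) * h1

end Weights

/-! Sums over the orderings of a list. -/

section Orderings

theorem sum_map_permutations'Aux {α : Type*} (f : List α → ℝ) (x : α) (l : List α) :
    ((List.permutations'Aux x l).map f).sum =
      ∑ i ∈ Finset.range (l.length + 1), f (l.insertIdx i x) := by
  induction l generalizing f with
  | nil => simp [List.permutations'Aux]
  | cons a l ih =>
    rw [List.permutations'Aux, List.map_cons, List.sum_cons, List.map_map, ih, List.length_cons,
      Finset.sum_range_succ' _ (l.length + 1), add_comm]
    simp

/-- Replaces conditioning on the order of all nodes but `x`: given that order, the position of `x`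
is uniform. -/
theorem sum_map_permutations' {α : Type*} [DecidableEq α] (f : List α → ℝ) {x : α} {l : List α}
    (hx : x ∈ l) :
    (l.permutations'.map f).sum = ((l.erase x).permutations'.map fun l' =>
      ∑ i ∈ Finset.range (l'.length + 1), f (l'.insertIdx i x)).sum := by
  rw [((List.perm_cons_erase hx).permutations'.map f).sum_eq, List.permutations']
  generalize (l.erase x).permutations' = L
  induction L with
  | nil => simp
  | cons a L ih => simp [ih, sum_map_permutations'Aux]

theorem length_permutations'_eq {α : Type*} (l : List α) :
    l.permutations'.length = l.length.factorial := by
  rw [← (List.permutations_perm_permutations' l).length_eq, List.length_permutations]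

theorem sum_map_finset_sum {α ι : Type*} (L : List α) (W : Finset ι) (F : ι → α → ℝ) :
    (L.map fun a => ∑ w ∈ W, F w a).sum = ∑ w ∈ W, (L.map (F w)).sum := by
  induction L with
  | nil => simp
  | cons a L ih => simp [ih, Finset.sum_add_distrib]

theorem idxOf_insertIdx_self {α : Type*} [DecidableEq α] {x : α} {l : List α} (hx : x ∉ l) {i : ℕ}
    (hi : i ≤ l.length) : (l.insertIdx i x).idxOf x = i := by
  induction l generalizing i with
  | nil => obtain rfl : i = 0 := by simpa using hi
           simp
  | cons a l ih =>
    rw [List.mem_cons, not_or] at hx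
    cases i with
    | zero => simp
    | succ i =>
      rw [List.insertIdx_succ_cons, List.idxOf_cons_ne _ (Ne.symm hx.1), ih hx.2 (by simpa using hi)]

theorem idxOf_insertIdx_of_ne {α : Type*} [DecidableEq α] {x y : α} (hxy : y ≠ x) {l : List α}
    {i : ℕ} (hi : i ≤ l.length) :
    (l.insertIdx i x).idxOf y = if l.idxOf y < i then l.idxOf y else l.idxOf y + 1 := by
  induction l generalizing i with
  | nil => obtain rfl : i = 0 := by simpa using hi
           simp [List.idxOf_cons_ne _ hxy.symm]
  | cons a l ih =>
    cases i with
    | zero => simp [List.idxOf_cons_ne _ hxy.symm]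
    | succ i =>
      rw [List.insertIdx_succ_cons]
      by_cases ha : a = y
      · subst ha; simp
      · rw [List.idxOf_cons_ne _ ha, List.idxOf_cons_ne _ ha, ih (by simpa using hi)]
        split_ifs <;> omega

theorem find?_eq_some_of_sublist {α : Type*} {p q : α → Bool} {l' l : List α} (h : l'.Sublist l)
    (hl : l.Nodup) (hqp : ∀ z ∈ l', q z = true → p z = true) {y : α} (hy : l.find? p = some y)
    (hyl : y ∈ l') (hqy : q y = true) : l'.find? q = some y := by
  induction h with
  | slnil => simp at hyl
  | cons a h ih =>
    rw [List.nodup_cons] at hl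
    by_cases ha : p a = true
    · rw [List.find?_cons_of_pos ha, Option.some.injEq] at hy
      exact absurd (hy ▸ h.subset hyl) hl.1
    · rw [List.find?_cons_of_neg ha] at hy
      exact ih hl.2 hqp hy hyl
  | cons_cons a h ih =>
    rw [List.nodup_cons] at hl
    by_cases ha : p a = true
    · rw [List.find?_cons_of_pos ha, Option.some.injEq] at hy
      subst hy
      rw [List.find?_cons_of_pos hqy]
    · rw [List.find?_cons_of_neg ha] at hy
      have hqa : ¬ q a = true := fun h' => ha (hqp a (by simp) h')
      rw [List.find?_cons_of_neg hqa]
      have hya : y ≠ a := fun h' => hqa (h' ▸ hqy)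
      exact ih hl.2 (fun z hz => hqp z (by simp [hz])) hy (by simpa [hya] using hyl)

theorem idxOf_le_of_find? {α : Type*} [DecidableEq α] {p : α → Bool} {l : List α} {y z : α}
    (hy : l.find? p = some y) (hz : p z = true) : l.idxOf y ≤ l.idxOf z := by
  induction l with
  | nil => simp at hy
  | cons a l ih =>
    by_cases ha : p a = true
    · rw [List.find?_cons_of_pos ha, Option.some.injEq] at hy
      simp [hy]
    · rw [List.find?_cons_of_neg ha] at hy
      have h1 : a ≠ y := fun h => ha (h ▸ List.find?_some hy)
      have h2 : a ≠ z := fun h => ha (h ▸ hz)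
      rw [List.idxOf_cons_ne _ h1, List.idxOf_cons_ne _ h2]
      exact Nat.succ_le_succ (ih hy)

end Orderings

/-! The RANKING algorithm and its competitive ratio. -/

section Ranking

variable {U : Type*} [DecidableEq U]

/-- The first neighbour in `R` that is not used. -/
def firstFree (R : List U) (used N : Finset U) : Option U :=
  R.find? fun u => decide (u ∈ N ∧ u ∉ used)

/-- The offline nodes matched by RANKING after the nodes with neighbourhoods `N 0, …, N (k-1)` have
arrived. -/
def rankingUsed (R : List U) (N : ℕ → Finset U) : ℕ → Finset U
  | 0 => ∅
  | k + 1 => rankingUsed R N k ∪ (firstFree R (rankingUsed R N k) (N k)).toFinset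

/-- The offline node to which RANKING matches the `k`-th online node. -/
def rankingMatch (R : List U) (N : ℕ → Finset U) (k : ℕ) : Option U :=
  firstFree R (rankingUsed R N k) (N k)

theorem rankingUsed_succ (R : List U) (N : ℕ → Finset U) (k : ℕ) :
    rankingUsed R N (k + 1) = rankingUsed R N k ∪ (rankingMatch R N k).toFinset := rfl

theorem firstFree_eq_some {R : List U} {used N : Finset U} {y : U}
    (h : firstFree R used N = some y) : y ∈ R ∧ y ∈ N ∧ y ∉ used :=
  ⟨List.mem_of_find?_eq_some h, by simpa using List.find?_some h⟩

theorem exists_firstFree {R : List U} {used N : Finset U} {z : U} (hR : z ∈ R) (hN : z ∈ N)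
    (hz : z ∉ used) : ∃ y, firstFree R used N = some y ∧ R.idxOf y ≤ R.idxOf z := by
  have h : (firstFree R used N).isSome := List.find?_isSome.2 ⟨z, hR, by simp [hN, hz]⟩
  obtain ⟨y, hy⟩ := Option.isSome_iff_exists.1 h
  exact ⟨y, hy, idxOf_le_of_find? hy (by simp [hN, hz])⟩

theorem rankingUsed_mono (R : List U) (N : ℕ → Finset U) : Monotone (rankingUsed R N) :=
  monotone_nat_of_le_succ fun _ => Finset.subset_union_left

theorem mem_rankingUsed_of_match {R : List U} {N : ℕ → Finset U} {k m : ℕ} (hk : k < m) {y : U}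
    (h : rankingMatch R N k = some y) : y ∈ rankingUsed R N m :=
  rankingUsed_mono R N (Nat.succ_le_of_lt hk) (by simp [rankingUsed_succ, h])

/-- With more offline nodes, more of the offline nodes stay free at every time. -/
theorem notMem_rankingUsed_of_sublist {R' R : List U} (h : R'.Sublist R) (hR : R.Nodup)
    (N : ℕ → Finset U) (k : ℕ) :
    ∀ z ∈ R', z ∉ rankingUsed R' N k → z ∉ rankingUsed R N k := by
  induction k with
  | zero => simp [rankingUsed]
  | succ k ih =>
    intro z hz hz'
    simp only [rankingUsed_succ, Finset.mem_union, Option.mem_toFinset, Option.mem_def,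
      not_or] at hz' ⊢
    refine ⟨ih z hz hz'.1, fun hm => hz'.2 ?_⟩
    refine find?_eq_some_of_sublist h hR (fun w hw hw' => ?_) hm hz ?_
    · simp only [decide_eq_true_eq] at hw' ⊢
      exact ⟨hw'.1, ih w hw hw'.2⟩
    · simpa using ⟨(firstFree_eq_some hm).2.1, hz'.1⟩

/-- Since `w` is still free in the run with more offline nodes, the online node finds something
there that is ranked no later than `w`. -/
theorem rankingMatch_of_sublist {R' R : List U} (h : R'.Sublist R) (hR : R.Nodup)
    {N : ℕ → Finset U} {k : ℕ} {w : U} (hw : rankingMatch R' N k = some w) :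
    ∃ y, rankingMatch R N k = some y ∧ R.idxOf y ≤ R.idxOf w :=
  have ⟨h1, h2, h3⟩ := firstFree_eq_some hw
  exists_firstFree (h.subset h1) h2 (notMem_rankingUsed_of_sublist h hR N k w h1 h3)

theorem firstFree_insertIdx {R : List U} {u : U} {i : ℕ} (hR : (R.insertIdx i u).Nodup)
    {used N : Finset U} (h : firstFree (R.insertIdx i u) used N ≠ some u) :
    firstFree R used N = firstFree (R.insertIdx i u) used N := by
  cases hy : firstFree (R.insertIdx i u) used N with
  | none =>
    rw [firstFree, List.find?_eq_none] at hy ⊢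
    exact fun x hx => hy x (List.subset_insertIdx _ _ _ hx)
  | some y =>
    obtain ⟨h1, h2, h3⟩ := firstFree_eq_some hy
    have hyu : y ≠ u := fun h' => h (h' ▸ hy)
    have hyR : y ∈ R := (List.eq_or_mem_of_mem_insertIdx h1).resolve_left hyu
    exact find?_eq_some_of_sublist (List.sublist_insertIdx _ _ _) hR (fun _ _ h' => h') hy hyR
      (by simp [h2, h3])

/-- An offline node that stays unmatched does not affect the run. -/
theorem rankingUsed_insertIdx {R : List U} {u : U} {i : ℕ} (hR : (R.insertIdx i u).Nodup)
    {N : ℕ → Finset U} {k : ℕ} (hu : u ∉ rankingUsed (R.insertIdx i u) N k) :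
    rankingUsed R N k = rankingUsed (R.insertIdx i u) N k := by
  induction k with
  | zero => rfl
  | succ k ih =>
    simp only [rankingUsed_succ, Finset.mem_union, Option.mem_toFinset, Option.mem_def,
      not_or] at hu ⊢
    rw [ih hu.1, rankingMatch, ih hu.1, firstFree_insertIdx hR hu.2]
    rfl

/-- If `u` is never taken, its neighbour must have preferred an earlier node, and deleting `u`
leaves the run unchanged. Contrapositively, `u` is matched whenever it is inserted no later than the
node that its neighbour gets without it. -/
theorem exists_rankingMatch_of_notMem {R : List U} {u : U} (huR : u ∉ R) {i : ℕ}
    (hi : i ≤ R.length) (hR : (R.insertIdx i u).Nodup) {N : ℕ → Finset U} {j m : ℕ} (hj : j < m)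
    (huN : u ∈ N j) (hu : u ∉ rankingUsed (R.insertIdx i u) N m) :
    ∃ y, rankingMatch R N j = some y ∧ R.idxOf y < i := by
  have hmem : u ∈ R.insertIdx i u := (List.mem_insertIdx hi).2 (Or.inl rfl)
  have huj : u ∉ rankingUsed (R.insertIdx i u) N j := fun h =>
    hu (rankingUsed_mono _ _ hj.le h)
  obtain ⟨y, hy, hle⟩ := exists_firstFree hmem huN huj
  have hyu : y ≠ u := fun h => hu (mem_rankingUsed_of_match hj (h ▸ hy))
  refine ⟨y, ?_, ?_⟩
  · rw [rankingMatch, rankingUsed_insertIdx hR huj, firstFree_insertIdx hR, hy]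
    rw [hy]
    simpa using hyu
  · rw [idxOf_insertIdx_self huR hi, idxOf_insertIdx_of_ne hyu hi] at hle
    split_ifs at hle with h
    · exact h
    · omega

/-- The dual value of an offline node. -/
noncomputable def offlineDual (n : ℕ) (R : List U) (N : ℕ → Finset U) (m : ℕ) (u : U) : ℝ :=
  if u ∈ rankingUsed R N m then rankWeight n (R.idxOf u) else 0

/-- The dual value of an online node. -/
noncomputable def onlineDual (n : ℕ) (R : List U) (N : ℕ → Finset U) (j : ℕ) : ℝ :=
  (rankingMatch R N j).elim 0 fun y => 1 - rankWeight n (R.idxOf y)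

theorem offlineDual_nonneg (n : ℕ) (R : List U) (N : ℕ → Finset U) (m : ℕ) (u : U) :
    0 ≤ offlineDual n R N m u := by
  unfold offlineDual
  split_ifs
  · exact rankWeight_nonneg _ _
  · exact le_rfl

theorem onlineDual_nonneg {n : ℕ} {R : List U} (hR : R.length = n + 1) (N : ℕ → Finset U) (j : ℕ) :
    0 ≤ onlineDual n R N j := by
  unfold onlineDual
  cases h : rankingMatch R N j with
  | none => simp
  | some y =>
    have := List.idxOf_lt_length_iff.2 (firstFree_eq_some h).1
    simpa using rankWeight_le_one (n := n) (by omega)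

/-- The expected dual value of an edge over the random position of its offline node. -/
theorem sum_dual_insertIdx {R : List U} (hR : R.Nodup) {u : U} (huR : u ∉ R) {N : ℕ → Finset U}
    {j m : ℕ} (hj : j < m) (huN : u ∈ N j) :
    ((R.length : ℝ) + 1) * (1 - 1 / Real.exp 1) ≤ ∑ i ∈ Finset.range (R.length + 1),
      (offlineDual R.length (R.insertIdx i u) N m u +
        onlineDual R.length (R.insertIdx i u) N j) := by
  have hnd : ∀ i ≤ R.length, (R.insertIdx i u).Nodup := fun i hi =>
    (List.perm_insertIdx u R hi).nodup_iff.2 (List.nodup_cons.2 ⟨huR, hR⟩)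
  have hoff : ∀ i ≤ R.length, (∀ y, rankingMatch R N j = some y → i ≤ R.idxOf y) →
      offlineDual R.length (R.insertIdx i u) N m u = rankWeight R.length i := fun i hi h => by
    rw [offlineDual, idxOf_insertIdx_self huR hi, if_pos]
    by_contra hu
    obtain ⟨y, hy, hlt⟩ := exists_rankingMatch_of_notMem huR hi (hnd i hi) hj huN hu
    exact absurd (h y hy) (by omega)
  have hlen : ∀ i ≤ R.length, (R.insertIdx i u).length = R.length + 1 := fun i hi =>
    List.length_insertIdx_of_le_length hi u
  cases hw : rankingMatch R N j with
  -- If the online node is unmatched without `u`, then `u` is matched at every position and its own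
  -- weights already suffice.
  | none =>
    rw [← sum_rankWeight]
    refine Finset.sum_le_sum fun i hi => ?_
    have hi' : i ≤ R.length := Nat.lt_succ_iff.1 (Finset.mem_range.1 hi)
    rw [hoff i hi' (by simp [hw])]
    linarith [onlineDual_nonneg (hlen i hi') N j]
  | some w =>
    have hwR := (firstFree_eq_some hw).1
    have hwu : w ≠ u := fun h => huR (h ▸ hwR)
    have hc : R.idxOf w < R.length := List.idxOf_lt_length_iff.2 hwR
    have hon : ∀ i ≤ R.length, 1 - rankWeight R.length ((R.insertIdx i u).idxOf w) ≤
        onlineDual R.length (R.insertIdx i u) N j := fun i hi => by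
      obtain ⟨y, hy, hle⟩ := rankingMatch_of_sublist (List.sublist_insertIdx R i u) (hnd i hi) hw
      rw [onlineDual, hy]
      have h1 : (R.insertIdx i u).idxOf w ≤ R.length := by
        rw [idxOf_insertIdx_of_ne hwu hi]
        split_ifs <;> omega
      exact sub_le_sub_left (rankWeight_mono hle h1) 1
    -- With `c` the rank of `w`: at a position `i ≤ c`, `u` is matched and pushes `w` to rank `c +
    -- 1`; at a later position `u` may be unmatched, but `w` keeps rank `c`. In both cases the
    -- online node does at least as well as `w`.
    have hbound : ∀ i ∈ Finset.range (R.length + 1),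
        (if i < R.idxOf w + 1 then
          rankWeight R.length i + (1 - rankWeight R.length (R.idxOf w + 1))
          else 1 - rankWeight R.length (R.idxOf w)) ≤
        offlineDual R.length (R.insertIdx i u) N m u +
          onlineDual R.length (R.insertIdx i u) N j := fun i hi => by
      have hi' : i ≤ R.length := Nat.lt_succ_iff.1 (Finset.mem_range.1 hi)
      have h1 := hon i hi'
      rw [idxOf_insertIdx_of_ne hwu hi'] at h1
      split_ifs with h
      · rw [if_neg (by omega)] at h1
        rw [hoff i hi' (fun y hy => by rw [hw, Option.some.injEq] at hy; subst hy; omega)]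
        linarith
      · rw [if_pos (by omega)] at h1
        linarith [offlineDual_nonneg R.length (R.insertIdx i u) N m u]
    refine le_trans (le_of_eq ?_) (Finset.sum_le_sum hbound)
    rw [← sum_rankWeight_prefix hc, Finset.sum_ite, Finset.sum_add_distrib, Finset.sum_const,
      Finset.sum_const]
    have e1 : (Finset.range (R.length + 1)).filter (fun i => i < R.idxOf w + 1) =
        Finset.range (R.idxOf w + 1) := by
      ext i; simp only [Finset.mem_filter, Finset.mem_range]; omega
    have e2 : ((Finset.range (R.length + 1)).filter (fun i => ¬ i < R.idxOf w + 1)).card =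
        R.length - R.idxOf w := by
      rw [Finset.filter_not, e1, Finset.card_sdiff_of_subset (Finset.range_subset_range.2 (by omega))]
      simp
    rw [e1, e2, Finset.card_range, nsmul_eq_mul, nsmul_eq_mul, Nat.cast_sub hc.le]
    push_cast
    ring

/-- The dual values add up to the size of the matching. -/
theorem card_rankingUsed_eq (n : ℕ) (R : List U) (N : ℕ → Finset U) (m : ℕ) :
    ((rankingUsed R N m).card : ℝ) =
      ∑ u ∈ rankingUsed R N m, rankWeight n (R.idxOf u) +
        ∑ j ∈ Finset.range m, onlineDual n R N j := by
  induction m with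
  | zero => simp [rankingUsed]
  | succ m ih =>
    rw [Finset.sum_range_succ, rankingUsed_succ, onlineDual]
    cases h : rankingMatch R N m with
    | none => simpa using ih
    | some y =>
      have hy : y ∉ rankingUsed R N m := (firstFree_eq_some h).2.2
      have hd : Disjoint (rankingUsed R N m) {y} := by simpa using hy
      rw [Option.toFinset_some, Finset.card_union_of_disjoint hd, Finset.sum_union hd]
      push_cast
      rw [ih]
      simp
      ring

/-- The edges `(pos w, mate w)` are disjoint, so each nonnegative dual value is counted at most
once. -/
theorem sum_dual_le {n : ℕ} {R : List U} (hR : R.length = n + 1) (N : ℕ → Finset U) (m : ℕ)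
    {ι : Type*} (W : Finset ι) {pos : ι → ℕ} {mate : ι → U} (hpos : Set.InjOn pos W)
    (hmate : Set.InjOn mate W) (hm : ∀ w ∈ W, pos w < m) :
    ∑ w ∈ W, (offlineDual n R N m (mate w) + onlineDual n R N (pos w)) ≤
      ((rankingUsed R N m).card : ℝ) := by
  classical
  rw [card_rankingUsed_eq n, Finset.sum_add_distrib]
  refine add_le_add ?_ ?_
  · rw [← Finset.sum_image (f := offlineDual n R N m) hmate]
    simp only [offlineDual]
    rw [← Finset.sum_filter]
    refine Finset.sum_le_sum_of_subset_of_nonneg (fun u hu => (Finset.mem_filter.1 hu).2) ?_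
    exact fun _ _ _ => rankWeight_nonneg _ _
  · rw [← Finset.sum_image (f := onlineDual n R N) hpos]
    refine Finset.sum_le_sum_of_subset_of_nonneg (fun j hj => ?_)
      fun _ _ _ => onlineDual_nonneg hR N _
    obtain ⟨w, hw, rfl⟩ := Finset.mem_image.1 hj
    exact Finset.mem_range.2 (hm w hw)

/-- RANKING matches at least `1 - 1/e` times the size of any given matching, on average over the
orderings of the offline nodes. -/
theorem ranking_competitive {l : List U} (hl : l.Nodup) (N : ℕ → Finset U) (m : ℕ) {ι : Type*}
    (W : Finset ι) {pos : ι → ℕ} {mate : ι → U} (hpos : Set.InjOn pos W)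
    (hmate : Set.InjOn mate W) (hm : ∀ w ∈ W, pos w < m) (hN : ∀ w ∈ W, mate w ∈ N (pos w))
    (hmem : ∀ w ∈ W, mate w ∈ l) :
    (l.length.factorial : ℝ) * ((1 - 1 / Real.exp 1) * W.card) ≤
      (l.permutations'.map fun R => ((rankingUsed R N m).card : ℝ)).sum := by
  rcases W.eq_empty_or_nonempty with rfl | ⟨w₀, hw₀⟩
  · simp only [Finset.card_empty, Nat.cast_zero, mul_zero]
    refine List.sum_nonneg fun x hx => ?_
    obtain ⟨R, -, rfl⟩ := List.mem_map.1 hx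
    positivity
  -- The weights are indexed by the number of offline nodes minus one, which is why the empty case
  -- is separate.
  obtain ⟨n, hn⟩ : ∃ n, l.length = n + 1 :=
    ⟨l.length - 1, by have := List.length_pos_of_mem (hmem w₀ hw₀); omega⟩
  have h1 : (l.permutations'.map fun R => ∑ w ∈ W,
      (offlineDual n R N m (mate w) + onlineDual n R N (pos w))).sum ≤
      (l.permutations'.map fun R => ((rankingUsed R N m).card : ℝ)).sum :=
    List.sum_le_sum fun R hR => sum_dual_le
      (by rw [(List.mem_permutations'.1 hR).length_eq, hn]) N m W hpos hmate hm
  refine le_trans ?_ h1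
  rw [sum_map_finset_sum]
  have h2 : ∀ w ∈ W, (l.length.factorial : ℝ) * (1 - 1 / Real.exp 1) ≤ (l.permutations'.map fun R =>
      offlineDual n R N m (mate w) + onlineDual n R N (pos w)).sum := fun w hw => by
    rw [sum_map_permutations' _ (hmem w hw)]
    have hlen : (l.erase (mate w)).length = n := by
      rw [List.length_erase_of_mem (hmem w hw), hn, Nat.add_sub_cancel]
    have h3 : ∀ R ∈ (l.erase (mate w)).permutations', ((n : ℝ) + 1) * (1 - 1 / Real.exp 1) ≤
        ∑ i ∈ Finset.range (R.length + 1), (offlineDual n (R.insertIdx i (mate w)) N m (mate w) +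
          onlineDual n (R.insertIdx i (mate w)) N (pos w)) := fun R hR => by
      have hp := List.mem_permutations'.1 hR
      have hRn : R.length = n := hp.length_eq.trans hlen
      have := sum_dual_insertIdx (hp.nodup_iff.2 (hl.erase _))
        (fun h => (hl.mem_erase_iff.1 (hp.mem_iff.1 h)).1 rfl) (hm w hw) (hN w hw)
      rwa [hRn] at this ⊢
    have h4 := List.sum_le_sum h3
    rw [List.map_const', List.sum_replicate, length_permutations'_eq, hlen, nsmul_eq_mul] at h4
    refine le_trans (le_of_eq ?_) h4
    rw [hn, Nat.factorial_succ]
    push_cast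
    ring
  refine le_trans (le_of_eq ?_) (Finset.sum_le_sum h2)
  rw [Finset.sum_const, nsmul_eq_mul]
  ring

end Ranking

/-! The online phase. -/

section OnlinePhase

set_option linter.unusedSectionVars false

variable {U P : Type*} [Fintype U] [DecidableEq U] [Fintype P] [DecidableEq P]
  {H : P → Finset U} {M : Finset (P × U)} {R : List U}

theorem recognize_eq_some {seen : Finset P} {N : Finset U} {v : P}
    (h : recognize H seen N = some v) : H v = N ∧ v ∉ seen := by
  simpa using List.find?_some h

theorem recognize_eq_none {seen : Finset P} {N : Finset U} (h : recognize H seen N = none) {v : P}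
    (hv : v ∉ seen) : H v ≠ N := by
  rw [recognize, List.find?_eq_none] at h
  intro hN
  exact h v (by simp) (by simp [hN, hv])

theorem partner_eq_some {v : P} {u : U} (h : partner M v = some u) : (v, u) ∈ M := by
  simpa using List.find?_some h

theorem isSome_partner {v : P} (h : ∃ u, (v, u) ∈ M) : (partner M v).isSome := by
  obtain ⟨u, hu⟩ := h
  exact List.find?_isSome.2 ⟨u, by simp, by simpa using hu⟩

theorem onlineDecision_of_some {seen : Finset P} {used N : Finset U} {v : P}
    (h : recognize H seen N = some v) : onlineDecision H M R seen used N = partner M v := by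
  simp only [onlineDecision, h]

theorem onlineDecision_of_none {seen : Finset P} {used N : Finset U}
    (h : recognize H seen N = none) :
    onlineDecision H M R seen used N = firstFree R used N := by
  simp only [onlineDecision, h]
  rfl

theorem onlineState_append (past : List (Finset U)) (N : Finset U) :
    onlineState H M R (past ++ [N]) =
      ((onlineState H M R past).1 ∪ (recognize H (onlineState H M R past).1 N).toFinset,
        (onlineState H M R past).2 ∪ (onlinePhase H M R past N).toFinset) := by
  simp [onlineState, onlinePhase]

/-- The invariant behind feasibility: a newly recognized `v` is unseen and `R` avoids `M`, so
nothing matched earlier can be `M(v)`. -/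
theorem mem_used_onlineState (past : List (Finset U)) :
    ∀ u ∈ (onlineState H M R past).2,
      u ∈ R ∨ ∃ v ∈ (onlineState H M R past).1, (v, u) ∈ M := by
  induction past using List.reverseRecOn with
  | nil => simp [onlineState]
  | append_singleton past N ih =>
    rw [onlineState_append]
    intro u hu
    rcases Finset.mem_union.1 hu with hu | hu
    · rcases ih u hu with h | ⟨v, hv, h⟩
      · exact Or.inl h
      · exact Or.inr ⟨v, Finset.mem_union_left _ hv, h⟩
    · rw [Option.mem_toFinset, Option.mem_def, onlinePhase] at hu
      cases hr : recognize H (onlineState H M R past).1 N with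
      | some v =>
        rw [onlineDecision_of_some hr] at hu
        exact Or.inr ⟨v, by simp, partner_eq_some hu⟩
      | none =>
        rw [onlineDecision_of_none hr] at hu
        exact Or.inl (firstFree_eq_some hu).1

theorem choice_mem_used (l : List (Finset U)) (j : Fin l.length) (i : ℕ) (hij : (j : ℕ) < i) {u : U}
    (h : (onlinePhase H M R).choice l j = some u) : u ∈ (onlineState H M R (l.take i)).2 := by
  induction i with
  | zero => omega
  | succ i ih =>
    by_cases hi : i < l.length
    · rw [List.take_succ_eq_append_getElem hi, onlineState_append]
      rcases Nat.lt_succ_iff_lt_or_eq.1 hij with hlt | rfl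
      · exact Finset.mem_union_left _ (ih hlt)
      · refine Finset.mem_union_right _ ?_
        simpa [OnlineStrategy.choice] using h
    · have h1 := ih (by have := j.2; omega)
      rw [List.take_of_length_le (by omega)] at h1 ⊢
      exact h1

theorem feasible_onlinePhase (hM : IsMatching H M) (hR : ∀ u ∈ R, ∀ v, (v, u) ∉ M) :
    (onlinePhase H M R).Feasible := by
  intro l i u hu
  have key : u ∈ l.get i ∧ u ∉ (onlineState H M R (l.take i)).2 := by
    rw [OnlineStrategy.choice, onlinePhase] at hu
    cases hr : recognize H (onlineState H M R (l.take i)).1 (l.get i) with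
    | some v =>
      rw [onlineDecision_of_some hr] at hu
      have hvu := partner_eq_some hu
      refine ⟨(recognize_eq_some hr).1 ▸ hM.1 _ hvu, fun hused => ?_⟩
      rcases mem_used_onlineState _ u hused with h | ⟨w, hw, h⟩
      · exact hR u h v hvu
      · have : v = w := congrArg Prod.fst (hM.2.2 _ hvu _ h rfl)
        exact (recognize_eq_some hr).2 (this ▸ hw)
    | none =>
      rw [onlineDecision_of_none hr] at hu
      exact (firstFree_eq_some hu).2
  exact ⟨key.1, fun j hj hju => key.2 (choice_mem_used l j i hj hju)⟩

/-- The number of nodes matched in the online phase, from a given state on. -/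
noncomputable def matchedCount (H : P → Finset U) (M : Finset (P × U)) (R : List U) :
    Finset P → Finset U → List (Finset U) → ℕ
  | _, _, [] => 0
  | seen, used, N :: l =>
    (if (onlineDecision H M R seen used N).isSome = true then 1 else 0) +
      matchedCount H M R (seen ∪ (recognize H seen N).toFinset)
        (used ∪ (onlineDecision H M R seen used N).toFinset) l

/-- The neighbourhoods of the nodes that are not recognized as predicted nodes. -/
noncomputable def unrecognized (H : P → Finset U) : Finset P → List (Finset U) → List (Finset U)
  | _, [] => []
  | seen, N :: l =>
    match recognize H seen N with
    | some v => unrecognized H (insert v seen) l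
    | none => N :: unrecognized H seen l

theorem size_onlinePhase (l : List (Finset U)) :
    (onlinePhase H M R).size l = matchedCount H M R ∅ ∅ l := by
  -- Arbitrary starting states are needed for the induction on the list.
  have key : ∀ (l : List (Finset U)) (s : Finset P × Finset U),
      ∑ i : Fin l.length, (if (onlineDecision H M R
        ((l.take i).foldl (fun s N => (s.1 ∪ (recognize H s.1 N).toFinset,
          s.2 ∪ (onlineDecision H M R s.1 s.2 N).toFinset)) s).1
        ((l.take i).foldl (fun s N => (s.1 ∪ (recognize H s.1 N).toFinset,
          s.2 ∪ (onlineDecision H M R s.1 s.2 N).toFinset)) s).2 (l.get i)).isSome = true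
        then 1 else 0) = matchedCount H M R s.1 s.2 l := by
    intro l
    induction l with
    | nil => intro s; simp [matchedCount]
    | cons N l ih =>
      intro s
      rw [matchedCount, ← ih (s.1 ∪ (recognize H s.1 N).toFinset,
        s.2 ∪ (onlineDecision H M R s.1 s.2 N).toFinset)]
      exact Fin.sum_univ_succ _
  rw [OnlineStrategy.size, Finset.card_filter]
  exact key l (∅, ∅)

/-- The invariant `hl` says that enough nodes are still to come for every unseen predicted node to
be recognized. The set `used` contains the partners under `M` as well, while `used'` contains only
what RANKING took; they agree on `R`, so RANKING runs as if the recognized nodes did not exist. -/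
theorem matchedCount_eq (hM : ∀ v, ∃ u, (v, u) ∈ M) (hR : ∀ u ∈ R, ∀ v, (v, u) ∉ M)
    (l : List (Finset U)) (seen : Finset P) (used used' : Finset U)
    (hl : (Finset.univ \ seen).val.map H ≤ (l : Multiset (Finset U)))
    (hu : ∀ u ∈ R, u ∈ used ↔ u ∈ used') :
    (Finset.univ \ seen).val.map H + (unrecognized H seen l : Multiset (Finset U)) = l ∧
    matchedCount H M R seen used l + used'.card = (Finset.univ \ seen).card +
      ((unrecognized H seen l).foldl (fun s N => s ∪ (firstFree R s N).toFinset) used').card := by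
  induction l generalizing seen used used' with
  | nil =>
    have h0 : (Finset.univ \ seen).val = 0 := by simpa using hl
    have h1 : (Finset.univ \ seen).card = 0 := by rw [Finset.card_def, h0]; rfl
    simp [h0, h1, unrecognized, matchedCount]
  | cons N l ih =>
    cases hr : recognize H seen N with
    | some v =>
      obtain ⟨hv, hvs⟩ := recognize_eq_some hr
      have hins : Finset.univ \ seen = insert v (Finset.univ \ insert v seen) := by
        ext w; by_cases hw : w = v <;> simp [hw, hvs]
      have hval : (Finset.univ \ seen).val = v ::ₘ (Finset.univ \ insert v seen).val := by
        conv_lhs => rw [hins]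
        exact Finset.insert_val_of_notMem (by simp)
      rw [hval, Multiset.map_cons, hv, ← Multiset.cons_coe, Multiset.cons_le_cons_iff] at hl
      obtain ⟨u, hvu⟩ := Option.isSome_iff_exists.1 (isSome_partner (hM v))
      have hu' : ∀ r ∈ R, r ∈ used ∪ {u} ↔ r ∈ used' := fun r hrR => by
        have : r ≠ u := fun h => hR r hrR v (h ▸ partner_eq_some hvu)
        simp [this, hu r hrR]
      obtain ⟨h1, h2⟩ := ih (insert v seen) (used ∪ {u}) used' hl hu'
      have hunr : unrecognized H seen (N :: l) = unrecognized H (insert v seen) l := by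
        simp only [unrecognized, hr]
      have hcard : (Finset.univ \ seen).card = (Finset.univ \ insert v seen).card + 1 := by
        rw [Finset.card_def, hval, Multiset.card_cons]; rfl
      have hseen : seen ∪ {v} = insert v seen := by rw [Finset.union_comm]; rfl
      rw [hunr, hval, Multiset.map_cons, hv, Multiset.cons_add, h1, hcard, matchedCount,
        onlineDecision_of_some hr, hvu, hr, Option.toFinset_some, Option.toFinset_some, hseen]
      refine ⟨rfl, ?_⟩
      simp only [Option.isSome_some, if_true]
      omega
    | none =>
      have hN : N ∉ (Finset.univ \ seen).val.map H := fun h => by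
        obtain ⟨v, hv, hvN⟩ := Multiset.mem_map.1 h
        exact recognize_eq_none hr (Finset.mem_sdiff.1 hv).2 hvN
      rw [← Multiset.cons_coe, Multiset.le_cons_of_notMem hN] at hl
      have hunr : unrecognized H seen (N :: l) = N :: unrecognized H seen l := by
        simp only [unrecognized, hr]
      have hfree : firstFree R used N = firstFree R used' N := by
        unfold firstFree
        refine List.find?_congr fun r hrR => ?_
        simp [hu r hrR]
      have hu' : ∀ r ∈ R, r ∈ used ∪ (firstFree R used' N).toFinset ↔
          r ∈ used' ∪ (firstFree R used' N).toFinset := fun r hrR => by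
        simp only [Finset.mem_union, hu r hrR]
      obtain ⟨h1, h2⟩ := ih seen _ _ hl hu'
      rw [hunr, ← Multiset.cons_coe, ← Multiset.cons_coe, Multiset.add_cons, h1, matchedCount,
        onlineDecision_of_none hr, hr, hfree, List.foldl_cons, ← h2, Option.toFinset_none,
        Finset.union_empty]
      refine ⟨rfl, ?_⟩
      cases hy : firstFree R used' N with
      | none => simp
      | some y =>
        have hy' := (firstFree_eq_some hy).2.2
        rw [Option.toFinset_some, Finset.card_union_of_disjoint (by simpa using hy')]
        simp
        omega

theorem rankingUsed_eq_foldl (R : List U) (L : List (Finset U)) {k : ℕ} (hk : k ≤ L.length) :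
    rankingUsed R (fun j => L.getD j ∅) k =
      (L.take k).foldl (fun s N => s ∪ (firstFree R s N).toFinset) ∅ := by
  induction k with
  | zero => rfl
  | succ k ih =>
    rw [List.take_succ_eq_append_getElem (by omega), List.foldl_append, ← ih (by omega)]
    simp only [rankingUsed, List.foldl_cons, List.foldl_nil]
    rw [List.getD_eq_getElem _ _ (by omega)]

/-- Used to let each unrecognized arrival stand for a distinct adversarial node with the same
neighbourhood, whatever its true identity. -/
theorem exists_list_map_eq {α β : Type*} (f : α → β) (L : List β) (s : Multiset α)
    (h : (L : Multiset β) = s.map f) : ∃ L' : List α, (L' : Multiset α) = s ∧ L'.map f = L := by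
  classical
  induction L generalizing s with
  | nil => exact ⟨[], by simpa [eq_comm] using h, rfl⟩
  | cons b L ih =>
    have hb : b ∈ s.map f := h ▸ by simp
    obtain ⟨a, ha, rfl⟩ := Multiset.mem_map.1 hb
    obtain ⟨t, rfl⟩ := Multiset.exists_cons_of_mem ha
    rw [Multiset.map_cons, ← Multiset.cons_coe, Multiset.cons_inj_right] at h
    obtain ⟨L', h1, h2⟩ := ih t h
    exact ⟨a :: L', by rw [← h1]; rfl, by simp [h2]⟩

/-- For a fixed matching `M` of all predicted nodes, the online phase matches all predicted nodes,
and on average at least `1 - 1/e` times any matching between adversarial and reserved nodes. -/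
theorem onlinePhase_competitive {V : Type*} [DecidableEq V] {G : V → Finset U} {VA : Finset V}
    {l : List (Finset U)}
    (hl : (l : Multiset (Finset U)) = (Finset.univ : Finset P).val.map H + VA.val.map G)
    (hM : ∀ v, ∃ u, (v, u) ∈ M) {A : List U} (hA : A.Nodup) (hAM : ∀ u ∈ A, ∀ v, (v, u) ∉ M)
    {mate : V → U} (hmate : Function.Injective mate) (hG : ∀ v, mate v ∈ G v) :
    (A.length.factorial : ℝ) * (Fintype.card P +
        (1 - 1 / Real.exp 1) * (VA.filter fun v => mate v ∈ A).card) ≤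
      (A.permutations'.map fun R => ((onlinePhase H M R).size l : ℝ)).sum := by
  have hle : (Finset.univ \ (∅ : Finset P)).val.map H ≤ (l : Multiset (Finset U)) := by
    rw [hl, Finset.sdiff_empty]
    exact Multiset.le_add_right _ _
  have hsize : ∀ R ∈ A.permutations', ((onlinePhase H M R).size l : ℝ) = Fintype.card P +
      ((rankingUsed R (fun j => (unrecognized H ∅ l).getD j ∅)
        (unrecognized H ∅ l).length).card : ℝ) := fun R hR => by
    have hRM : ∀ u ∈ R, ∀ v, (v, u) ∉ M := fun u hu =>
      hAM u ((List.mem_permutations'.1 hR).mem_iff.1 hu)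
    have h := (matchedCount_eq hM hRM l ∅ ∅ ∅ hle (fun _ _ => Iff.rfl)).2
    rw [Finset.sdiff_empty, Finset.card_empty, add_zero, Finset.card_univ] at h
    rw [size_onlinePhase, h, rankingUsed_eq_foldl R _ le_rfl, List.take_length]
    push_cast
    rfl
  -- Recognition does not depend on `R`, so the empty sequence serves here.
  have hunr : (unrecognized H ∅ l : Multiset (Finset U)) = VA.val.map G := by
    have h := (matchedCount_eq (R := []) hM (by simp) l ∅ ∅ ∅ hle (by simp)).1
    rw [Finset.sdiff_empty, hl] at h
    exact add_left_cancel h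
  obtain ⟨L, hL, hLG⟩ := exists_list_map_eq G _ _ hunr
  have hmemL : ∀ v ∈ VA, L.idxOf v < L.length := fun v hv =>
    List.idxOf_lt_length_iff.2 (by rw [← Multiset.mem_coe, hL]; exact hv)
  have hlen : (unrecognized H ∅ l).length = L.length := by rw [← hLG, List.length_map]
  have hrank := ranking_competitive hA (fun j => (unrecognized H ∅ l).getD j ∅)
    (unrecognized H ∅ l).length (VA.filter fun v => mate v ∈ A) (pos := fun v => L.idxOf v)
    (mate := mate)
    (fun v hv w hw h => (List.idxOf_inj (List.idxOf_lt_length_iff.1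
      (hmemL v (Finset.mem_filter.1 hv).1))).1 h)
    hmate.injOn
    (fun v hv => by rw [hlen]; exact hmemL v (Finset.mem_filter.1 hv).1)
    (fun v hv => by
      have h := hmemL v (Finset.mem_filter.1 hv).1
      rw [List.getD_eq_getElem _ _ (by rw [hlen]; exact h)]
      have : (unrecognized H ∅ l)[L.idxOf v]'(by rw [hlen]; exact h) = G v := by
        simp [← hLG]
      rw [this]
      exact hG v)
    (fun v hv => (Finset.mem_filter.1 hv).2)
  rw [List.map_congr_left hsize, List.sum_map_add, List.map_const', List.sum_replicate,
    length_permutations'_eq, nsmul_eq_mul, mul_add]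
  exact add_le_add le_rfl hrank

end OnlinePhase

/-! Matching skeletons exist: they are the level sets of the assignment of least energy. -/

section Skeleton

set_option linter.unusedSectionVars false

theorem IsMatching.exists_mem {U P : Type*} {H : P → Finset U} {M : Finset (P × U)}
    (hM : IsMatching H M) {S : Finset P} (hS : ∀ e ∈ M, e.1 ∈ S) (hc : M.card = S.card) {v : P}
    (hv : v ∈ S) : ∃ u, (v, u) ∈ M := by
  classical
  have h1 : M.image Prod.fst ⊆ S := fun w hw => by
    obtain ⟨e, he, rfl⟩ := Finset.mem_image.1 hw
    exact hS e he
  have h2 : (M.image Prod.fst).card = M.card :=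
    Finset.card_image_of_injOn fun e he f hf h => hM.2.1 e he f hf h
  rw [← Finset.eq_of_subset_of_card_le h1 (by omega)] at hv
  obtain ⟨e, he, rfl⟩ := Finset.mem_image.1 hv
  exact ⟨e.2, he⟩

variable {U P : Type*} [Fintype U] [Fintype P]

theorem exists_injective_of_matchingNumber_eq {H : P → Finset U}
    (h : matchingNumber H = Fintype.card P) :
    ∃ m : P → U, Function.Injective m ∧ ∀ v, m v ∈ H v := by
  classical
  have hne : (Finset.univ.filter fun M => IsMatching H M).Nonempty :=
    ⟨∅, by simp [IsMatching]⟩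
  obtain ⟨M, hM, hc⟩ := Finset.exists_mem_eq_sup _ hne Finset.card
  have hM' : IsMatching H M := (Finset.mem_filter.1 hM).2
  have hcard : M.card = (Finset.univ : Finset P).card := by
    rw [← hc, Finset.card_univ, ← h, matchingNumber]
  choose m hm using fun v => hM'.exists_mem (fun e _ => Finset.mem_univ e.1) hcard
    (Finset.mem_univ v)
  exact ⟨m, fun v w hvw => congrArg Prod.fst (hM'.2.2 _ (hm v) _ (hm w) hvw),
    fun v => hM'.1 _ (hm v)⟩

/-- The fractional assignments of all online nodes to neighbours. -/
def fractionalAssignments (H : P → Finset U) : Set (P → U → ℝ) :=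
  {x | (∀ v u, 0 ≤ x v u) ∧ (∀ v u, u ∉ H v → x v u = 0) ∧ ∀ v, ∑ u, x v u = 1}

theorem isCompact_fractionalAssignments (H : P → Finset U) :
    IsCompact (fractionalAssignments H) := by
  have hclosed : IsClosed (fractionalAssignments H) := by
    simp only [fractionalAssignments, Set.ofPred_and, Set.ofPred_forall]
    refine IsClosed.inter ?_ (IsClosed.inter ?_ ?_)
    · exact isClosed_iInter fun v => isClosed_iInter fun u =>
        isClosed_le continuous_const (by fun_prop)
    · exact isClosed_iInter fun v => isClosed_iInter fun u => isClosed_iInter fun _ =>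
        isClosed_eq (by fun_prop) continuous_const
    · exact isClosed_iInter fun v => isClosed_eq (by fun_prop) continuous_const
  refine (isCompact_Icc (a := (0 : P → U → ℝ)) (b := 1)).of_isClosed_subset hclosed fun x hx => ?_
  refine ⟨fun v u => hx.1 v u, fun v u => ?_⟩
  exact (Finset.single_le_sum (f := fun u => x v u) (fun w _ => hx.1 v w)
    (Finset.mem_univ u)).trans_eq (hx.2.2 v)

/-- In an assignment of least energy, online nodes are assigned only to neighbours of least
degree. -/
theorem exists_balanced_assignment {H : P → Finset U} (hne : (fractionalAssignments H).Nonempty) :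
    ∃ x ∈ fractionalAssignments H, ∀ v u u', 0 < x v u → u' ∈ H v →
      ∑ w, x w u ≤ ∑ w, x w u' := by
  classical
  obtain ⟨x, hx, hmin⟩ := (isCompact_fractionalAssignments H).exists_isMinOn hne
    (f := fun x => ∑ u, (∑ w, x w u) ^ 2) (by fun_prop)
  refine ⟨x, hx, fun v u u' hpos hu' => ?_⟩
  by_contra! hlt
  have hne' : u ≠ u' := by rintro rfl; exact lt_irrefl _ hlt
  have huH : u ∈ H v := by
    by_contra h
    exact hpos.ne' (hx.2.1 v u h)
  set D := ∑ w, x w u - ∑ w, x w u' with hD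
  have hDpos : 0 < D := by linarith
  -- Moving mass `ε` at `v` from `u` to `u'` changes the energy by `-2εD + 2ε²`, which is at most
  -- `-εD < 0` when `ε ≤ D / 2`.
  obtain ⟨ε, hε, hεx, hεD⟩ : ∃ ε > 0, ε ≤ x v u ∧ ε ≤ D / 2 :=
    ⟨min (x v u) (D / 2), lt_min hpos (by linarith), min_le_left _ _, min_le_right _ _⟩
  let a : U → ℝ := fun w => (if w = u' then ε else 0) - (if w = u then ε else 0)
  have hx' : (fun v' w => x v' w + if v' = v then a w else 0) ∈ fractionalAssignments H := by
    refine ⟨fun v' w => ?_, fun v' w hw => ?_, fun v' => ?_⟩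
    · have h0 := hx.1 v' w
      dsimp only [a]
      split_ifs with h1 h2 h3 h3
      · linarith
      · linarith
      · subst h1 h3; linarith
      · linarith
      · linarith
    · have h0 := hx.2.1 v' w hw
      dsimp only [a]
      by_cases h1 : v' = v
      · subst h1
        rw [h0, if_pos rfl, if_neg (fun h : w = u' => hw (h ▸ hu')), if_neg (fun h : w = u => hw (h ▸ huH))]
        simp
      · simp [h0, h1]
    · rw [Finset.sum_add_distrib, hx.2.2 v']
      by_cases h1 : v' = v <;> simp [h1, a]
  have h1 := hmin hx'
  simp only [Set.mem_ofPred_eq, Finset.sum_add_distrib, Finset.sum_ite_eq', Finset.mem_univ,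
    if_true] at h1
  have h2 : ∑ w, (∑ v, x v w + a w) ^ 2 = ∑ w, (∑ v, x v w) ^ 2 +
      (2 * ε * (∑ v, x v u') - 2 * ε * (∑ v, x v u) + ε ^ 2 + ε ^ 2) := by
    have h3 : ∀ w, (∑ v, x v w + a w) ^ 2 = (∑ v, x v w) ^ 2 +
        ((if w = u' then 2 * ε * (∑ v, x v w) + ε ^ 2 else 0) +
          (if w = u then - (2 * ε * (∑ v, x v w)) + ε ^ 2 else 0)) := fun w => by
      dsimp only [a]
      by_cases h4 : w = u'
      · have h5 : w ≠ u := fun h => hne' (h.symm.trans h4)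
        rw [if_pos h4, if_neg h5, if_pos h4, if_neg h5]
        ring
      · rw [if_neg h4, if_neg h4]
        split_ifs <;> ring
    simp only [h3, Finset.sum_add_distrib, Finset.sum_ite_eq', Finset.mem_univ, if_true]
    ring
  rw [h2] at h1
  nlinarith

/-- Numbers the level sets of `y` by decreasing value; `Fin.rev` makes the largest value come first.
-/
theorem exists_antitone_index (y : U → ℝ) :
    ∃ (k : ℕ) (t : U → Fin k), Function.Surjective t ∧ ∀ u u', t u < t u' ↔ y u' < y u := by
  classical
  let Y : Finset ℝ := Finset.univ.image y
  have hy : ∀ u, y u ∈ Y := fun u => Finset.mem_image_of_mem y (Finset.mem_univ u)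
  refine ⟨Y.card, fun u => Fin.rev ((Y.orderIsoOfFin rfl).symm ⟨y u, hy u⟩), fun j => ?_,
    fun u u' => ?_⟩
  · obtain ⟨u, -, hu⟩ := Finset.mem_image.1 ((Y.orderIsoOfFin rfl) (Fin.rev j)).2
    refine ⟨u, ?_⟩
    have : (⟨y u, hy u⟩ : Y) = (Y.orderIsoOfFin rfl) (Fin.rev j) := Subtype.ext hu
    simp only [this, OrderIso.symm_apply_apply, Fin.rev_rev]
  · rw [Fin.rev_lt_rev, OrderIso.lt_iff_lt, Subtype.mk_lt_mk]

/-- The parts `T i` are the level sets of the offline degree in a balanced assignment. By balance,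
all offline nodes to which `v` gives mass share one level, which places `v` in its part; the witness
`f v` is any of them. -/
theorem nonempty_matchingSkeleton [DecidableEq U] [DecidableEq P] {H : P → Finset U}
    (h : matchingNumber H = Fintype.card P) : Nonempty (MatchingSkeleton H) := by
  obtain ⟨m, hm, hmH⟩ := exists_injective_of_matchingNumber_eq h
  have hne : (fractionalAssignments H).Nonempty := by
    refine ⟨fun v u => if u = m v then 1 else 0, fun v u => ?_, fun v u hu => ?_, fun v => ?_⟩
    · dsimp only; split_ifs <;> norm_num
    · exact if_neg fun h' : u = m v => hu (h' ▸ hmH v)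
    · simp
  obtain ⟨x, ⟨hx0, hxH, hx1⟩, hbal⟩ := exists_balanced_assignment hne
  obtain ⟨k, t, ht, hty⟩ := exists_antitone_index fun u => ∑ w, x w u
  have hmem : ∀ {v u}, 0 < x v u → u ∈ H v := fun {v u} hp => by
    by_contra h'
    exact hp.ne' (hxH v u h')
  have hf : ∀ v, ∃ u, 0 < x v u := fun v => by
    by_contra! h'
    have := Finset.sum_nonpos fun u (_ : u ∈ Finset.univ) => h' u
    linarith [hx1 v]
  choose f hf using hf
  have hteq : ∀ {u u'}, ∑ w, x w u = ∑ w, x w u' → t u = t u' := fun {u u'} he =>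
    le_antisymm (not_lt.1 fun h' => (((hty _ _).1 h').ne he))
      (not_lt.1 fun h' => (((hty _ _).1 h').ne he.symm))
  have hyeq : ∀ {u u'}, t u = t u' → ∑ w, x w u = ∑ w, x w u' := fun {u u'} he =>
    le_antisymm (not_lt.1 fun h' => (((hty _ _).2 h').ne he))
      (not_lt.1 fun h' => (((hty _ _).2 h').ne he.symm))
  have hpos : ∀ {v u}, 0 < x v u → t (f v) = t u := fun {v u} hp =>
    hteq (le_antisymm (hbal v _ _ (hf v) (hmem hp)) (hbal v _ _ hp (hmem (hf v))))
  have hwithin : ∀ v u, t (f v) ≠ t u → x v u = 0 := fun v u hn => by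
    by_contra h'
    exact hn (hpos (lt_of_le_of_ne (hx0 v u) (Ne.symm h')))
  -- Double counting: the mass received by a level is one unit from each online node of that level,
  -- and it is spread evenly over the offline nodes of the level.
  have hcount : ∀ u, ((Finset.univ.filter fun v => t (f v) = t u).card : ℝ) =
      ((Finset.univ.filter fun u' => t u' = t u).card : ℝ) * ∑ w, x w u := fun u => by
    have h1 : ∑ u' ∈ Finset.univ.filter (fun u' => t u' = t u), ∑ w, x w u' =
        ((Finset.univ.filter fun u' => t u' = t u).card : ℝ) * ∑ w, x w u := by
      rw [Finset.sum_congr rfl fun u' hu' => hyeq (Finset.mem_filter.1 hu').2, Finset.sum_const,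
        nsmul_eq_mul]
    rw [← h1, Finset.sum_comm, Finset.card_filter]
    push_cast
    refine Finset.sum_congr rfl fun v _ => ?_
    rw [Finset.sum_filter]
    split_ifs with hv
    · rw [← hx1 v]
      refine Finset.sum_congr rfl fun u' _ => ?_
      split_ifs with hu'
      · rfl
      · exact hwithin v u' fun h' => hu' (h'.symm.trans hv)
    · refine (Finset.sum_eq_zero fun u' _ => ?_).symm
      split_ifs with hu'
      · exact hwithin v u' fun h' => hv (h'.trans hu')
      · rfl
  have hTpos : ∀ u, (0 : ℝ) < ((Finset.univ.filter fun u' => t u' = t u).card : ℝ) := fun u => by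
    exact_mod_cast Finset.card_pos.2 ⟨u, by simp⟩
  have hratio : ∀ u, ((Finset.univ.filter fun v => t (f v) = t u).card : ℝ) /
      ((Finset.univ.filter fun u' => t u' = t u).card : ℝ) = ∑ w, x w u := fun u => by
    rw [hcount, mul_div_cancel_left₀ _ (hTpos u).ne']
  -- It suffices to bound the top level. Online nodes of that level have all their neighbours in it,
  -- so the injection `m` shows that the level has no more online than offline nodes.
  have hdeg : ∀ u, ∑ w, x w u ≤ 1 := fun u => by
    obtain ⟨u₀, -, hu₀⟩ := Finset.exists_max_image Finset.univ (fun u => ∑ w, x w u) ⟨u, by simp⟩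
    refine (hu₀ u (by simp)).trans ?_
    rw [← hratio u₀, div_le_one (hTpos u₀), Nat.cast_le]
    refine Finset.card_le_card_of_injOn m (fun v hv => ?_) hm.injOn
    have hv' : t (f v) = t u₀ := by simpa using hv
    have h1 : ∑ w, x w (m v) = ∑ w, x w u₀ := le_antisymm (hu₀ _ (by simp))
      ((hyeq hv').symm.le.trans (hbal v _ _ (hf v) (hmH v)))
    simpa using hteq h1
  exact ⟨{
    k := k
    sIndex := fun v => t (f v)
    tIndex := t
    x := x
    tIndex_surjective := ht
    neighbors := fun j u => by
      constructor
      · rintro ⟨v, hv, hu⟩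
        refine lt_of_le_of_lt (not_lt.1 fun h' => ?_) hv
        exact absurd ((hty _ _).1 h') (not_lt.2 (hbal v _ _ (hf v) hu))
      · intro hu
        -- A node strictly before level `j` has degree larger than some nonnegative degree, hence
        -- receives mass from some online node, which lies in the same part.
        obtain ⟨u', rfl⟩ := ht j
        have h1 := (hty _ _).1 hu
        have h2 : 0 ≤ ∑ w, x w u' := Finset.sum_nonneg fun w _ => hx0 w u'
        obtain ⟨v, -, hv⟩ := Finset.exists_lt_of_sum_lt (s := Finset.univ) (f := fun _ : P => (0 : ℝ))
          (g := fun w => x w u) (by simpa using h2.trans_lt h1)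
        exact ⟨v, (hpos hv).symm ▸ hu, hmem hv⟩
    ratio_strictAnti := fun i j hij => by
      obtain ⟨u, rfl⟩ := ht i
      obtain ⟨u', rfl⟩ := ht j
      dsimp only
      rw [hratio, hratio]
      exact (hty _ _).1 hij
    fractional := {
      nonneg := hx0
      le_one := fun v u => (Finset.single_le_sum (f := fun u => x v u) (fun w _ => hx0 v w)
        (Finset.mem_univ u)).trans_eq (hx1 v)
      support := hxH
      online_degree_le := fun v => (hx1 v).le
      offline_degree_le := hdeg }
    within := hwithin
    online_degree := hx1
    offline_degree := fun u => (hratio u).symm }⟩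

end Skeleton

/-! Dependent roundings exist, by Birkhoff's theorem. -/

section Rounding

set_option linter.unusedSectionVars false

variable {U P : Type*} [Fintype U] [DecidableEq U] [Fintype P] [DecidableEq P]

/-- Pad `x` to a doubly stochastic matrix by `r = |U| - |P|` dummy online nodes that share equally
the missing degree of each offline node, then apply Birkhoff's theorem. -/
theorem exists_random_injection {x : P → U → ℝ} (h0 : ∀ v u, 0 ≤ x v u)
    (hrow : ∀ v, ∑ u, x v u = 1) (hcol : ∀ u, ∑ v, x v u ≤ 1) :
    ∃ (w : Equiv.Perm U → ℝ) (m : Equiv.Perm U → P → U), (∀ σ, 0 ≤ w σ) ∧ ∑ σ, w σ = 1 ∧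
      (∀ σ, Function.Injective (m σ)) ∧ ∀ v u, x v u = ∑ σ, if m σ v = u then w σ else 0 := by
  have hsum : (Fintype.card P : ℝ) = ∑ u, ∑ v, x v u := by
    rw [Finset.sum_comm]
    simp [hrow]
  have hle : Fintype.card P ≤ Fintype.card U := by
    have : (Fintype.card P : ℝ) ≤ Fintype.card U := by
      rw [hsum]
      exact (Finset.sum_le_sum fun u _ => hcol u).trans (by simp)
    exact_mod_cast this
  obtain ⟨r, hr⟩ := Nat.exists_eq_add_of_le hle
  let e : P ⊕ Fin r ≃ U := Fintype.equivOfCardEq (by simp [hr])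
  have hr' : ∑ u, (1 - ∑ v, x v u) = r := by
    rw [Finset.sum_sub_distrib, ← hsum]
    simp [hr]
  let A : Matrix U U ℝ := fun a u =>
    Sum.elim (fun v => x v u) (fun _ : Fin r => (1 - ∑ v, x v u) / r) (e.symm a)
  have hA : A ∈ doublyStochastic ℝ U := by
    rw [mem_doublyStochastic_iff_sum]
    refine ⟨fun a u => ?_, fun a => ?_, fun u => ?_⟩
    · dsimp only [A]
      rcases e.symm a with v | j
      · exact h0 v u
      · exact div_nonneg (sub_nonneg.2 (hcol u)) (Nat.cast_nonneg r)
    · dsimp only [A]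
      rcases e.symm a with v | j
      · exact hrow v
      · have : (r : ℝ) ≠ 0 := by
          have := j.pos
          positivity
        simp only [Sum.elim_inr]
        rw [← Finset.sum_div, hr', div_self this]
    · dsimp only [A]
      rw [Equiv.sum_comp e.symm (fun s =>
        Sum.elim (fun v => x v u) (fun _ : Fin r => (1 - ∑ v, x v u) / r) s), Fintype.sum_sum_type]
      simp only [Sum.elim_inl, Sum.elim_inr, Finset.sum_const, Finset.card_univ, Fintype.card_fin,
        nsmul_eq_mul]
      -- Without dummy nodes there must be no missing degree: the deficits are nonnegative and add
      -- up to `r = 0`.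
      rcases Nat.eq_zero_or_pos r with h | h
      · have h1 : 1 - ∑ v, x v u = 0 :=
          (Finset.sum_eq_zero_iff_of_nonneg fun u _ => sub_nonneg.2 (hcol u)).1
            (by rw [hr', h, Nat.cast_zero]) u (Finset.mem_univ u)
        rw [h1, zero_div, mul_zero]
        linarith
      · have : (r : ℝ) ≠ 0 := by positivity
        rw [mul_div_cancel₀ _ this]
        ring
  obtain ⟨w, hw0, hw1, hwA⟩ := exists_eq_sum_perm_of_mem_doublyStochastic hA
  refine ⟨w, fun σ v => σ (e (Sum.inl v)), hw0, hw1,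
    fun σ => σ.injective.comp (e.injective.comp Sum.inl_injective), fun v u => ?_⟩
  have h1 := congrFun (congrFun hwA (e (Sum.inl v))) u
  simp only [A, Equiv.symm_apply_apply, Sum.elim_inl] at h1
  rw [← h1, Matrix.sum_apply]
  simp [Equiv.toPEquiv_apply, eq_comm]

/-- One random injection of all predicted nodes serves every component by restriction to `S i`. It
only uses pairs with positive `x`, hence edges of `H` inside a component. -/
theorem MatchingSkeleton.exists_isRounding {H : P → Finset U} (K : MatchingSkeleton H) :
    ∃ D : Fin K.k → PMF (Finset (P × U)), ∀ i, K.IsRounding i (D i) := by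
  obtain ⟨w, m, hw0, hw1, hm, hx⟩ := exists_random_injection K.fractional.nonneg K.online_degree
    K.fractional.offline_degree_le
  let p : PMF (Equiv.Perm U) := PMF.ofFintype (fun σ => ENNReal.ofReal (w σ)) (by
    rw [← ENNReal.ofReal_sum_of_nonneg fun σ _ => hw0 σ, hw1, ENNReal.ofReal_one])
  have hpos : ∀ σ ∈ p.support, ∀ v, 0 < K.x v (m σ v) := fun σ hσ v => by
    have h1 : 0 < w σ := by
      rw [PMF.mem_support_ofFintype_iff] at hσ
      exact not_le.1 fun h => hσ (ENNReal.ofReal_eq_zero.2 h)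
    rw [hx v]
    refine h1.trans_le ?_
    have h2 := Finset.single_le_sum (f := fun τ => if m τ v = m σ v then w τ else 0)
      (fun τ _ => by split_ifs; exacts [hw0 τ, le_rfl]) (Finset.mem_univ σ)
    simpa using h2
  refine ⟨fun i => p.map fun σ => (K.S i).image fun v => (v, m σ v), fun i => ⟨?_, ?_⟩⟩
  · intro M hM
    obtain ⟨σ, hσ, rfl⟩ := (PMF.mem_support_map_iff _ _ _).1 hM
    have hmem : ∀ v, m σ v ∈ H v := fun v => by
      by_contra h
      exact (hpos σ hσ v).ne' (K.fractional.support v _ h)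
    have hidx : ∀ v, K.tIndex (m σ v) = K.sIndex v := fun v => by
      by_contra h
      exact (hpos σ hσ v).ne' (K.within v _ (Ne.symm h))
    refine ⟨⟨fun e he => ?_, fun e he f hf h => ?_, fun e he f hf h => ?_⟩, fun e he => ?_, ?_⟩
    · obtain ⟨v, -, rfl⟩ := Finset.mem_image.1 he
      exact hmem v
    · obtain ⟨v, -, rfl⟩ := Finset.mem_image.1 he
      obtain ⟨v', -, rfl⟩ := Finset.mem_image.1 hf
      obtain rfl : v = v' := h
      rfl
    · obtain ⟨v, -, rfl⟩ := Finset.mem_image.1 he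
      obtain ⟨v', -, rfl⟩ := Finset.mem_image.1 hf
      obtain rfl : v = v' := hm σ h
      rfl
    · obtain ⟨v, hv, rfl⟩ := Finset.mem_image.1 he
      refine Finset.mem_product.2 ⟨hv, ?_⟩
      simp only [MatchingSkeleton.S, MatchingSkeleton.T, Finset.mem_filter, Finset.mem_univ,
        true_and] at hv ⊢
      exact (hidx v).trans hv
    · exact Finset.card_image_of_injective _ fun v v' h => congrArg Prod.fst h
  · intro v hv u _
    rw [PMF.toOuterMeasure_map_apply, PMF.toOuterMeasure_apply_fintype, hx v u,
      ENNReal.ofReal_sum_of_nonneg fun σ _ => by split_ifs; exacts [hw0 σ, le_rfl]]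
    refine Finset.sum_congr rfl fun σ _ => ?_
    by_cases h : m σ v = u
    · rw [if_pos h, Set.indicator_of_mem]
      · rfl
      · exact Finset.mem_image.2 ⟨v, hv, by rw [h]⟩
    · rw [if_neg h, Set.indicator_of_notMem, ENNReal.ofReal_zero]
      intro h'
      obtain ⟨v', -, h2⟩ := Finset.mem_image.1 h'
      obtain ⟨rfl, h3⟩ := Prod.mk.inj h2
      exact h h3

end Rounding

/-! Expected sizes. -/

section Expectation

variable {U : Type*}

theorem OnlineStrategy.size_le_length (σ : OnlineStrategy U) (l : List (Finset U)) :
    σ.size l ≤ l.length :=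
  (Finset.card_filter_le _ _).trans_eq (by simp)

/-- There are infinitely many strategies; in `ℝ≥0∞` the sums can be interchanged freely. -/
theorem expectedSize_eq_toReal (p : PMF (OnlineStrategy U)) (l : List (Finset U)) :
    expectedSize p l = (∑' σ, p σ * (σ.size l : ℝ≥0∞)).toReal := by
  rw [ENNReal.tsum_toReal_eq fun σ => ENNReal.mul_ne_top (p.apply_ne_top σ) (by simp)]
  simp [expectedSize]

theorem tsum_size_ne_top (p : PMF (OnlineStrategy U)) (l : List (Finset U)) :
    ∑' σ, p σ * (σ.size l : ℝ≥0∞) ≠ ∞ := by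
  refine ne_top_of_le_ne_top (b := (l.length : ℝ≥0∞)) (by simp) ?_
  calc ∑' σ, p σ * (σ.size l : ℝ≥0∞) ≤ ∑' σ, p σ * (l.length : ℝ≥0∞) :=
        ENNReal.tsum_le_tsum fun σ => by gcongr; exact_mod_cast σ.size_le_length l
    _ = l.length := by rw [ENNReal.tsum_mul_right, p.tsum_coe, one_mul]

theorem expectedSize_bind {α : Type*} [Fintype α] (p : PMF α) (q : α → PMF (OnlineStrategy U))
    (l : List (Finset U)) :
    expectedSize (p.bind q) l = ∑ a, (p a).toReal * expectedSize (q a) l := by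
  have h : ∑' σ, (p.bind q) σ * (σ.size l : ℝ≥0∞) =
      ∑ a, p a * ∑' σ, q a σ * (σ.size l : ℝ≥0∞) := by
    simp only [PMF.bind_apply, ← ENNReal.tsum_mul_right]
    rw [ENNReal.tsum_comm, tsum_fintype]
    simp only [mul_assoc, ENNReal.tsum_mul_left]
  rw [expectedSize_eq_toReal, h, ENNReal.toReal_sum fun a _ =>
    ENNReal.mul_ne_top (p.apply_ne_top a) (tsum_size_ne_top (q a) l)]
  simp only [ENNReal.toReal_mul, expectedSize_eq_toReal]

theorem expectedSize_map {α : Type*} [Fintype α] (p : PMF α) (F : α → OnlineStrategy U)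
    (l : List (Finset U)) :
    expectedSize (p.map F) l = ∑ a, (p a).toReal * ((F a).size l : ℝ) := by
  have h : ∀ σ : OnlineStrategy U, expectedSize (PMF.pure σ) l = σ.size l := fun σ => by
    rw [expectedSize, tsum_eq_single σ fun τ hτ => by simp [PMF.pure_apply, hτ]]
    simp
  rw [← PMF.bind_pure_comp, expectedSize_bind]
  simp [h]

theorem sum_toReal_eq_one {α : Type*} [Fintype α] (p : PMF α) : ∑ a, (p a).toReal = 1 := by
  rw [← ENNReal.toReal_sum fun a _ => p.apply_ne_top a, ← tsum_fintype (L := .unconditional _),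
    p.tsum_coe, ENNReal.toReal_one]

theorem sum_toReal_mul_ite {α : Type*} [Fintype α] (p : PMF α) (s : α → Prop) [DecidablePred s] :
    ∑ a, (p a).toReal * (if s a then 1 else 0) = (p.toOuterMeasure {a | s a}).toReal := by
  have h : ∀ a, {a | s a}.indicator p a ≠ ∞ := fun a => by
    by_cases ha : s a
    · rw [Set.indicator_of_mem (by exact ha)]
      exact p.apply_ne_top a
    · rw [Set.indicator_of_notMem (by exact ha)]
      exact ENNReal.zero_ne_top
  rw [PMF.toOuterMeasure_apply_fintype, ENNReal.toReal_sum fun a _ => h a]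
  refine Finset.sum_congr rfl fun a _ => ?_
  by_cases ha : s a
  · rw [Set.indicator_of_mem (by exact ha), if_pos ha, mul_one]
  · rw [Set.indicator_of_notMem (by exact ha), if_neg ha, mul_zero, ENNReal.toReal_zero]

theorem sum_equiv_ofFn {α : Type*} [DecidableEq α] (A : Finset α) (f : List α → ℝ) :
    ∑ e : Fin A.card ≃ A, f (List.ofFn fun i => (e i : α)) =
      (A.toList.permutations'.map f).sum := by
  have hperm := List.permutations_perm_permutations' A.toList
  have hnd : A.toList.permutations'.Nodup :=
    hperm.nodup_iff.1 (List.nodup_permutations _ A.nodup_toList)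
  have hinj : Function.Injective
      fun e : Fin A.card ≃ A => List.ofFn fun i => (e i : α) := fun e e' h => by
    have h' := List.ofFn_injective h
    exact Equiv.ext fun i => Subtype.ext (congrFun h' i)
  have himage : (Finset.univ.image fun e : Fin A.card ≃ A => List.ofFn fun i => (e i : α)) =
      A.toList.permutations'.toFinset := by
    refine Finset.eq_of_subset_of_card_le (fun R hR => ?_) ?_
    · obtain ⟨e, -, rfl⟩ := Finset.mem_image.1 hR
      have hnd' : (List.ofFn fun i => (e i : α)).Nodup :=
        List.nodup_ofFn.2 (Subtype.val_injective.comp e.injective)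
      rw [List.mem_toFinset, List.mem_permutations',
        List.perm_ext_iff_of_nodup hnd' A.nodup_toList]
      intro a
      rw [List.mem_ofFn, Finset.mem_toList]
      exact ⟨fun ⟨i, hi⟩ => hi ▸ (e i).2, fun ha => ⟨e.symm ⟨a, ha⟩, by simp⟩⟩
    · rw [Finset.card_image_of_injective _ hinj, List.toFinset_card_of_nodup hnd,
        length_permutations'_eq, Finset.length_toList, Finset.card_univ,
        Fintype.card_equiv A.equivFin.symm, Fintype.card_fin]
  rw [← List.sum_toFinset f hnd, ← himage, Finset.sum_image hinj.injOn]

end Expectation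

/-! The random matching of Structured Sampling. -/

section SampledMatching

set_option linter.unusedSectionVars false

variable {U P : Type*} [Fintype U] [DecidableEq U] [Fintype P] [DecidableEq P] {H : P → Finset U}

theorem mem_support_independentLaw {k : ℕ} {α : Type*} [Fintype α] {D : Fin k → PMF α}
    {f : Fin k → α} (hf : f ∈ (independentLaw D).support) (i : Fin k) : f i ∈ (D i).support := by
  rw [independentLaw, PMF.mem_support_ofFintype_iff, Finset.prod_ne_zero_iff] at hf
  exact hf i (Finset.mem_univ i)

theorem independentLaw_marginal {k : ℕ} {α : Type*} [Fintype α] (D : Fin k → PMF α) (i : Fin k)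
    (s : Set α) : (independentLaw D).toOuterMeasure {f | f i ∈ s} = (D i).toOuterMeasure s := by
  classical
  have hsum : ∀ j, ∑ a, D j a = 1 := fun j => by
    rw [← tsum_fintype (L := .unconditional _), (D j).tsum_coe]
  have h : ∀ f : Fin k → α, {f | f i ∈ s}.indicator (independentLaw D) f =
      ∏ j, (if j = i then s.indicator (D j) (f j) else D j (f j)) := fun f => by
    by_cases hf : f i ∈ s
    · rw [Set.indicator_of_mem (by exact hf)]
      change ∏ j, D j (f j) = _
      refine Finset.prod_congr rfl fun j _ => ?_
      split_ifs with hj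
      · subst hj
        rw [Set.indicator_of_mem hf]
      · rfl
    · rw [Set.indicator_of_notMem (by exact hf)]
      have h0 : (if i = i then s.indicator (D i) (f i) else D i (f i)) = 0 := by simp [hf]
      exact (Finset.prod_eq_zero (f := fun j =>
        if j = i then s.indicator (D j) (f j) else D j (f j)) (Finset.mem_univ i) h0).symm
  rw [PMF.toOuterMeasure_apply_fintype, PMF.toOuterMeasure_apply_fintype, Finset.sum_congr rfl
    fun f _ => h f, ← Fintype.piFinset_univ,
    ← Finset.prod_univ_sum (fun _ => Finset.univ)
      fun j a => if j = i then s.indicator (D j) a else D j a]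
  rw [Finset.prod_eq_single i (fun j _ hj => by simp [hj, hsum]) (by simp)]
  simp

variable {K : MatchingSkeleton H} {D : Fin K.k → PMF (Finset (P × U))}

theorem mem_component (hD : ∀ i, K.IsRounding i (D i)) {Mi : Fin K.k → Finset (P × U)}
    (hMi : Mi ∈ (independentLaw D).support) {i : Fin K.k} {e : P × U} (he : e ∈ Mi i) :
    K.sIndex e.1 = i ∧ K.tIndex e.2 = i := by
  have h := ((hD i).1 _ (mem_support_independentLaw hMi i)).2.1 he
  simpa [MatchingSkeleton.S, MatchingSkeleton.T] using h

theorem isMatching_biUnion (hD : ∀ i, K.IsRounding i (D i)) {Mi : Fin K.k → Finset (P × U)}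
    (hMi : Mi ∈ (independentLaw D).support) : IsMatching H (Finset.univ.biUnion Mi) := by
  have hM := fun i => ((hD i).1 _ (mem_support_independentLaw hMi i)).1
  refine ⟨fun e he => ?_, fun e he f hf h => ?_, fun e he f hf h => ?_⟩
  · obtain ⟨i, -, he⟩ := Finset.mem_biUnion.1 he
    exact (hM i).1 e he
  · obtain ⟨i, -, he⟩ := Finset.mem_biUnion.1 he
    obtain ⟨j, -, hf⟩ := Finset.mem_biUnion.1 hf
    obtain rfl : i = j := by
      rw [← (mem_component hD hMi he).1, ← (mem_component hD hMi hf).1, h]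
    exact (hM i).2.1 e he f hf h
  · obtain ⟨i, -, he⟩ := Finset.mem_biUnion.1 he
    obtain ⟨j, -, hf⟩ := Finset.mem_biUnion.1 hf
    obtain rfl : i = j := by
      rw [← (mem_component hD hMi he).2, ← (mem_component hD hMi hf).2, h]
    exact (hM i).2.2 e he f hf h

theorem exists_mem_biUnion (hD : ∀ i, K.IsRounding i (D i)) {Mi : Fin K.k → Finset (P × U)}
    (hMi : Mi ∈ (independentLaw D).support) (v : P) : ∃ u, (v, u) ∈ Finset.univ.biUnion Mi := by
  obtain ⟨hM, hsub, hcard⟩ := (hD (K.sIndex v)).1 _ (mem_support_independentLaw hMi (K.sIndex v))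
  obtain ⟨u, hu⟩ := hM.exists_mem (fun e he => (Finset.mem_product.1 (hsub he)).1) hcard
    (v := v) (by simp [MatchingSkeleton.S])
  exact ⟨u, Finset.mem_biUnion.2 ⟨_, Finset.mem_univ _, hu⟩⟩

theorem prob_mem_biUnion_le (hD : ∀ i, K.IsRounding i (D i)) (v : P) (u : U) :
    (independentLaw D).toOuterMeasure {Mi | (v, u) ∈ Finset.univ.biUnion Mi} ≤
      ENNReal.ofReal (K.x v u) := by
  by_cases h : K.tIndex u = K.sIndex v
  · rw [← (hD (K.sIndex v)).2 v (by simp [MatchingSkeleton.S]) u (by simp [MatchingSkeleton.T, h]),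
      ← independentLaw_marginal]
    refine PMF.toOuterMeasure_mono _ fun Mi hMi => ?_
    obtain ⟨i, -, hi⟩ := Finset.mem_biUnion.1 hMi.1
    have := (mem_component hD hMi.2 hi).1
    subst this
    exact hi
  · refine le_of_eq_of_le ?_ zero_le
    rw [PMF.toOuterMeasure_apply_eq_zero_iff, Set.disjoint_left]
    intro Mi hMi hmem
    obtain ⟨i, -, hi⟩ := Finset.mem_biUnion.1 hmem
    have h' := mem_component hD hMi hi
    exact h (h'.2.trans h'.1.symm)

/-- Union bound over the predicted nodes `p` that could take `mate v`, then linearity of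
expectation. -/
theorem expected_reserved_ge (hD : ∀ i, K.IsRounding i (D i)) {V : Type*} (VA : Finset V)
    (mate : V → U) :
    ∑ v ∈ VA, (1 - ∑ p, K.x p (mate v)) ≤ ∑ Mi, (independentLaw D Mi).toReal *
      ((VA.filter fun v => mate v ∈ reserved (Finset.univ.biUnion Mi)).card : ℝ) := by
  have h1 : ∀ Mi : Fin K.k → Finset (P × U), ∑ v ∈ VA, ((1 : ℝ) -
      ∑ p, if (p, mate v) ∈ Finset.univ.biUnion Mi then 1 else 0) ≤
      ((VA.filter fun v => mate v ∈ reserved (Finset.univ.biUnion Mi)).card : ℝ) := fun Mi => by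
    rw [Finset.card_filter]
    push_cast
    refine Finset.sum_le_sum fun v _ => ?_
    split_ifs with h
    · exact sub_le_self _ (Finset.sum_nonneg fun p _ => by split_ifs <;> norm_num)
    · simp only [reserved, Finset.mem_filter, Finset.mem_univ, true_and, not_forall,
        not_not] at h
      obtain ⟨p, hp⟩ := h
      have := Finset.single_le_sum
        (f := fun p => if (p, mate v) ∈ Finset.univ.biUnion Mi then (1 : ℝ) else 0)
        (fun p _ => by split_ifs <;> norm_num) (Finset.mem_univ p)
      simp only [hp, if_true] at this
      linarith
  refine le_trans ?_ (Finset.sum_le_sum fun Mi _ =>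
    mul_le_mul_of_nonneg_left (h1 Mi) ENNReal.toReal_nonneg)
  simp only [Finset.mul_sum, mul_sub, mul_one]
  rw [Finset.sum_comm]
  refine Finset.sum_le_sum fun v _ => ?_
  rw [Finset.sum_sub_distrib, sum_toReal_eq_one, Finset.sum_comm]
  refine sub_le_sub_left (Finset.sum_le_sum fun p _ => ?_) 1
  rw [sum_toReal_mul_ite]
  exact ENNReal.toReal_le_of_le_ofReal (K.fractional.nonneg _ _) (prob_mem_biUnion_le hD p (mate v))

/-- In a skeleton, the offline nodes of any matching of all online nodes have large degree in
total. -/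
theorem MatchingSkeleton.card_sq_le (K : MatchingSkeleton H) {m : P → U} (hm : ∀ v, m v ∈ H v) :
    (Fintype.card P : ℝ) ^ 2 ≤ Fintype.card U * ∑ v, ∑ w, K.x w (m v) := by
  let ratio : Fin K.k → ℝ := fun i =>
    ((Finset.univ.filter fun v => K.sIndex v = i).card : ℝ) /
      ((Finset.univ.filter fun u => K.tIndex u = i).card : ℝ)
  have hdeg : ∀ u, ∑ w, K.x w u = ratio (K.tIndex u) := K.offline_degree
  -- A neighbour of `v` cannot lie in a part later than that of `v`, and earlier parts have larger
  -- ratios.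
  have h1 : ∀ v, ratio (K.sIndex v) ≤ ∑ w, K.x w (m v) := fun v => by
    rw [hdeg]
    refine K.ratio_strictAnti.antitone (not_lt.1 fun h => ?_)
    exact lt_irrefl _ ((K.neighbors (K.tIndex (m v)) (m v)).1 ⟨v, h, hm v⟩)
  -- Where `x w u` is nonzero, the degree of `u` is the ratio of the component of `w`, and `w`
  -- distributes one unit.
  have h2 : ∑ u, (∑ w, K.x w u) ^ 2 = ∑ v, ratio (K.sIndex v) := by
    calc ∑ u, (∑ w, K.x w u) ^ 2 = ∑ u, ∑ w, K.x w u * ratio (K.sIndex w) := by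
          refine Finset.sum_congr rfl fun u _ => ?_
          rw [sq, Finset.sum_mul]
          refine Finset.sum_congr rfl fun w _ => ?_
          by_cases h : K.sIndex w = K.tIndex u
          · rw [hdeg, h]
          · rw [K.within w u h, zero_mul, zero_mul]
      _ = ∑ v, ratio (K.sIndex v) := by
          rw [Finset.sum_comm]
          exact Finset.sum_congr rfl fun w _ => by
            rw [← Finset.sum_mul, K.online_degree, one_mul]
  have h3 : ∑ u, ∑ w, K.x w u = Fintype.card P := by
    rw [Finset.sum_comm]
    simp [K.online_degree]
  have h4 := sq_sum_le_card_mul_sum_sq (s := Finset.univ) (f := fun u => ∑ w, K.x w u)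
  rw [h3, h2, Finset.card_univ] at h4
  exact h4.trans (mul_le_mul_of_nonneg_left (Finset.sum_le_sum fun v _ => h1 v) (by positivity))

theorem expectedSize_uniformOrdering_ge {V : Type*} [DecidableEq V] {G : V → Finset U}
    {VA : Finset V} {l : List (Finset U)} {M : Finset (P × U)}
    (hl : (l : Multiset (Finset U)) = (Finset.univ : Finset P).val.map H + VA.val.map G)
    (hM : ∀ v, ∃ u, (v, u) ∈ M) {mate : V → U} (hmate : Function.Injective mate)
    (hG : ∀ v, mate v ∈ G v) :
    (Fintype.card P : ℝ) +
        (1 - 1 / Real.exp 1) * ((VA.filter fun v => mate v ∈ reserved M).card : ℝ) ≤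
      expectedSize ((uniformOrdering (reserved M)).map fun R => onlinePhase H M R) l := by
  have h := onlinePhase_competitive (A := (reserved M).toList) hl hM (Finset.nodup_toList _)
    (fun u hu => by simpa [reserved] using hu) hmate hG
  simp only [Finset.length_toList, Finset.mem_toList] at h
  rw [← sum_equiv_ofFn] at h
  have hpos : (0 : ℝ) < ((reserved M).card.factorial : ℝ) := by positivity
  rw [uniformOrdering, PMF.map_comp, expectedSize_map]
  simp only [PMF.uniformOfFintype_apply, ← Finset.mul_sum, Function.comp_apply]
  rw [Fintype.card_equiv (reserved M).equivFin.symm, Fintype.card_fin, ENNReal.toReal_inv,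
    ENNReal.toReal_natCast, le_inv_mul_iff₀ hpos]
  exact h

theorem expectedSize_structuredSampling_ge (hD : ∀ i, K.IsRounding i (D i)) {V : Type*}
    [DecidableEq V] {G : V → Finset U} {VA : Finset V} {l : List (Finset U)}
    (hl : (l : Multiset (Finset U)) = (Finset.univ : Finset P).val.map H + VA.val.map G)
    {mate : V → U} (hmate : Function.Injective mate) (hG : ∀ v, mate v ∈ G v) :
    (Fintype.card P : ℝ) + (1 - 1 / Real.exp 1) * ∑ v ∈ VA, (1 - ∑ p, K.x p (mate v)) ≤
      expectedSize (structuredSampling K D) l := by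
  have he : 0 ≤ 1 - 1 / Real.exp 1 := by
    have : 1 ≤ Real.exp 1 := Real.one_le_exp zero_le_one
    rw [sub_nonneg, div_le_one (by positivity)]
    exact this
  have h1 : ∀ Mi, (independentLaw D Mi).toReal * ((Fintype.card P : ℝ) + (1 - 1 / Real.exp 1) *
      ((VA.filter fun v => mate v ∈ reserved (Finset.univ.biUnion Mi)).card : ℝ)) ≤
      (independentLaw D Mi).toReal * expectedSize ((uniformOrdering
        (reserved (Finset.univ.biUnion Mi))).map
          fun R => onlinePhase H (Finset.univ.biUnion Mi) R) l := fun Mi => by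
    by_cases hMi : Mi ∈ (independentLaw D).support
    · exact mul_le_mul_of_nonneg_left
        (expectedSize_uniformOrdering_ge hl (exists_mem_biUnion hD hMi) hmate hG)
        ENNReal.toReal_nonneg
    · rw [((independentLaw D).apply_eq_zero_iff Mi).2 hMi]
      simp
  rw [structuredSampling, expectedSize_bind]
  refine le_trans ?_ (Finset.sum_le_sum fun Mi _ => h1 Mi)
  simp only [mul_add, Finset.sum_add_distrib, ← Finset.sum_mul]
  rw [sum_toReal_eq_one, one_mul]
  refine add_le_add le_rfl ?_
  refine (mul_le_mul_of_nonneg_left (expected_reserved_ge hD VA mate) he).trans_eq ?_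
  rw [Finset.mul_sum]
  exact Finset.sum_congr rfl fun Mi _ => by ring

theorem feasible_of_mem_support_structuredSampling (hD : ∀ i, K.IsRounding i (D i)) :
    ∀ σ ∈ (structuredSampling K D).support, σ.Feasible := by
  intro σ hσ
  obtain ⟨Mi, hMi, hσ⟩ := (PMF.mem_support_bind_iff _ _ _).1 hσ
  obtain ⟨R, hR, rfl⟩ := (PMF.mem_support_map_iff _ _ _).1 hσ
  obtain ⟨e, -, rfl⟩ := (PMF.mem_support_map_iff _ _ _).1 hR
  refine feasible_onlinePhase (isMatching_biUnion hD hMi) fun u hu => ?_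
  obtain ⟨i, rfl⟩ := List.mem_ofFn.1 hu
  exact (Finset.mem_filter.1 (e i).2).2

end SampledMatching

/-! Perfect matchings. -/

section PerfectMatching

set_option linter.unusedSectionVars false

variable {U V : Type*} [Fintype U] [Fintype V] {G : V → Finset U}

theorem HasPerfectMatching.exists_bijective (h : HasPerfectMatching G) :
    ∃ m : V → U, Function.Bijective m ∧ ∀ v, m v ∈ G v := by
  obtain ⟨M, hM, hV, hU⟩ := h
  choose m hm using hV
  refine ⟨m, ⟨fun v w hvw => congrArg Prod.fst (hM.2.2 _ (hm v) _ (hm w) hvw), fun u => ?_⟩,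
    fun v => hM.1 _ (hm v)⟩
  obtain ⟨v, hv⟩ := hU u
  exact ⟨v, congrArg Prod.snd (hM.2.1 _ (hm v) _ hv rfl)⟩

theorem matchingNumber_le_card (G : V → Finset U) : matchingNumber G ≤ Fintype.card V := by
  classical
  refine Finset.sup_le fun M hM => ?_
  have hM' : IsMatching G M := (Finset.mem_filter.1 hM).2
  rw [← Finset.card_image_of_injOn (f := Prod.fst) fun e he f hf h => hM'.2.1 e he f hf h]
  exact Finset.card_le_univ _

theorem matchingNumber_eq_card {m : V → U} (hm : Function.Injective m) (hG : ∀ v, m v ∈ G v) :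
    matchingNumber G = Fintype.card V := by
  classical
  refine le_antisymm (matchingNumber_le_card G) ?_
  have hM : IsMatching G (Finset.univ.image fun v => (v, m v)) := by
    refine ⟨fun e he => ?_, fun e he f hf h => ?_, fun e he f hf h => ?_⟩
    · obtain ⟨v, -, rfl⟩ := Finset.mem_image.1 he
      exact hG v
    · obtain ⟨v, -, rfl⟩ := Finset.mem_image.1 he
      obtain ⟨w, -, rfl⟩ := Finset.mem_image.1 hf
      obtain rfl : v = w := h
      rfl
    · obtain ⟨v, -, rfl⟩ := Finset.mem_image.1 he
      obtain ⟨w, -, rfl⟩ := Finset.mem_image.1 hf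
      obtain rfl : v = w := hm h
      rfl
  have hc : (Finset.univ.image fun v => (v, m v)).card = Fintype.card V :=
    Finset.card_image_of_injective _ fun v w h => congrArg Prod.fst h
  rw [← hc]
  exact Finset.le_sup (f := Finset.card) (Finset.mem_filter.2 ⟨Finset.mem_univ _, hM⟩)

end PerfectMatching

/-! ### Existence of the algorithm and its competitive ratio. -/

theorem exists_isStructuredSampling : ∃ alg : SemiOnlineAlgorithm.{u}, alg.IsStructuredSampling := by
  classical
  let law : ∀ (U P : Type u) [Fintype U] [DecidableEq U] [Fintype P] [DecidableEq P]
      (_ : P → Finset U), PMF (OnlineStrategy U) := fun U P _ _ _ _ H =>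
    if h : ∃ (K : MatchingSkeleton H) (D : Fin K.k → PMF (Finset (P × U))),
        ∀ i, K.IsRounding i (D i)
    then structuredSampling h.choose h.choose_spec.choose
    -- On predicted graphs without a skeleton and roundings, abandoning every node is a feasible
    -- default.
    else PMF.pure fun _ _ => none
  refine ⟨⟨law, fun U P _ _ _ _ H σ hσ => ?_⟩, fun U P _ _ _ _ H hH => ?_⟩
  · by_cases h : ∃ (K : MatchingSkeleton H) (D : Fin K.k → PMF (Finset (P × U))),
        ∀ i, K.IsRounding i (D i)
    · simp only [law, dif_pos h] at hσ
      exact feasible_of_mem_support_structuredSampling h.choose_spec.choose_spec σ hσ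
    · simp only [law, dif_neg h] at hσ
      obtain rfl := (PMF.mem_support_pure_iff _ _).1 hσ
      intro l i u hu
      simp [OnlineStrategy.choice] at hu
  · obtain ⟨K⟩ := nonempty_matchingSkeleton hH
    have h : ∃ (K : MatchingSkeleton H) (D : Fin K.k → PMF (Finset (P × U))),
        ∀ i, K.IsRounding i (D i) := ⟨K, K.exists_isRounding⟩
    refine ⟨h.choose, h.choose_spec.choose, h.choose_spec.choose_spec, ?_⟩
    simp only [law, dif_pos h]

theorem SemiOnlineAlgorithm.IsStructuredSampling.isCompetitive {alg : SemiOnlineAlgorithm.{u}}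
    (halg : alg.IsStructuredSampling) :
    alg.IsCompetitive fun δ => 1 - δ + δ ^ 2 * (1 - 1 / Real.exp 1) := by
  intro U V _ _ _ _ G VP order hG
  obtain ⟨m, hm, hmG⟩ := hG.exists_bijective
  have hmP : Function.Injective fun v : {v // v ∈ VP} => m v.1 :=
    hm.1.comp Subtype.val_injective
  obtain ⟨K, D, hD, hlaw⟩ := halg U {v // v ∈ VP} (fun v => G v.1)
    (matchingNumber_eq_card hmP fun v => hmG v.1)
  rw [hlaw, matchingNumber_eq_card hm.1 hmG]
  have hVP : (Finset.univ : Finset {v // v ∈ VP}).map (Function.Embedding.subtype _) = VP := by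
    ext v; simp
  -- The arrival order enters only through this multiset of neighbourhoods.
  have hl : ((List.ofFn fun i => G (order i) : List (Finset U)) : Multiset (Finset U)) =
      (Finset.univ : Finset {v // v ∈ VP}).val.map (fun v => G v.1) + VPᶜ.val.map G := by
    have h1 : (Finset.univ : Finset {v // v ∈ VP}).val.map (fun v => G v.1) = VP.val.map G := by
      conv_rhs => rw [← hVP, Finset.map_val, Multiset.map_map]
      rfl
    have h2 : VP.val + VPᶜ.val = (Finset.univ : Finset V).val := by
      rw [← Finset.disjUnion_val _ _ disjoint_compl_right, Finset.disjUnion_eq_union,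
        Finset.union_compl]
    rw [h1, ← Multiset.map_add, h2, ← Fin.univ_val_map, ← Finset.map_univ_equiv order,
      Finset.map_val, Multiset.map_map]
    rfl
  have h1 := expectedSize_structuredSampling_ge hD hl hm.1 hmG
  refine le_trans ?_ h1
  have hcard : Fintype.card U = Fintype.card V := (Fintype.card_of_bijective hm).symm
  have hP : Fintype.card {v // v ∈ VP} + VPᶜ.card = Fintype.card V := by
    rw [Fintype.card_coe, Finset.card_add_card_compl]
  have h2 := K.card_sq_le (m := fun v => m v.1) fun v => hmG v.1
  have h3 : ∑ v ∈ VPᶜ, ∑ p, K.x p (m v) + ∑ v : {v // v ∈ VP}, ∑ p, K.x p (m v.1) =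
      Fintype.card {v // v ∈ VP} := by
    have h4 : ∑ v : {v // v ∈ VP}, ∑ p, K.x p (m v.1) = ∑ v ∈ VP, ∑ p, K.x p (m v) := by
      exact Finset.sum_coe_sort VP fun v => ∑ p, K.x p (m v)
    rw [h4, Finset.sum_compl_add_sum, hm.sum_comp (fun u => ∑ p, K.x p u), Finset.sum_comm]
    simp [K.online_degree]
  rcases Nat.eq_zero_or_pos (Fintype.card V) with h0 | hpos
  · have h4 : VPᶜ = ∅ := Finset.card_eq_zero.1 (by omega)
    simp [h0, h4]
  have hn : (0 : ℝ) < Fintype.card V := by exact_mod_cast hpos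
  have he : 0 ≤ 1 - 1 / Real.exp 1 := by
    rw [sub_nonneg, div_le_one (by positivity)]
    exact Real.one_le_exp zero_le_one
  have hP' : (Fintype.card {v // v ∈ VP} : ℝ) = Fintype.card V - VPᶜ.card := by
    rw [← hP]; push_cast; ring
  rw [hcard] at h2
  rw [Finset.sum_sub_distrib, Finset.sum_const, nsmul_eq_mul, mul_one]
  -- With `n` nodes and `d` adversarial ones, `h2` and `h3` bound the total degree of the
  -- adversarial mates by `(n - d) - (n - d)² / n = d - d² / n`.
  have h5 : (VPᶜ.card : ℝ) ^ 2 / Fintype.card V ≤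
      VPᶜ.card - ∑ v ∈ VPᶜ, ∑ p, K.x p (m v) := by
    rw [div_le_iff₀ hn]
    rw [hP'] at h2 h3
    have h6 : ∑ v ∈ VPᶜ, ∑ p, K.x p (m v) = Fintype.card V - VPᶜ.card -
        ∑ v : {v // v ∈ VP}, ∑ p, K.x p (m v.1) := by linarith
    rw [h6]
    nlinarith
  refine le_trans (le_of_eq ?_) (add_le_add le_rfl (mul_le_mul_of_nonneg_left h5 he))
  rw [hP']
  field_simp

end SemiOnline

theorem mainTheorem1 :
    (∃ alg : SemiOnline.SemiOnlineAlgorithm.{u}, alg.IsStructuredSampling) ∧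
    ∀ alg : SemiOnline.SemiOnlineAlgorithm.{u}, alg.IsStructuredSampling →
      alg.IsCompetitive fun δ => 1 - δ + δ ^ 2 * (1 - 1 / Real.exp 1) :=
  ⟨SemiOnline.exists_isStructuredSampling, fun _ h => h.isCompetitive⟩
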